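/- Let $d\ge 1$ and $1<p<1+\frac2d$. For a nonnegative self-adjoint operator $\gamma=\sum_{i\ge1}n_i|u_i\rangle\langle u_i|$ of finite trace on $L^2(\mathbb R^d,\mathbb C)$ ($n_i\ge0$, $(u_i)$ orthonormal) put $\mathrm{Tr}(-\Delta\gamma)=\sum_i n_i\int_{\mathbb R^d}|\nabla u_i|^2\in[0,\infty]$ and $\rho_\gamma=\sum_i n_i|u_i|^2$ (these do not depend on the diagonalisation), and, if $\mathrm{Tr}(-\Delta\gamma)<\infty$, $$\mathcal E(\gamma)=\mathrm{Tr}(-\Delta\gamma)-\frac1p\int_{\mathbb R^d}\rho_\gamma(x)^p\,dx .$$ For $\lambda\ge0$ let $$J(\lambda)=\inf\{\mathcal E(\gamma):\ 0\le\gamma=\gamma^*\le1,\ \mathrm{Tr}\,\gamma=\lambda,\ \mathrm{Tr}(-\Delta\gamma)<\infty\},$$ $$I(\lambda)=\inf\Big\{\int_{\mathbb R^d}|\nabla u|^2-\frac1p\int_{\mathbb R^d}|u|^{2p}:\ u\in H^1(\mathbb R^d),\ \int_{\mathbb R^d}|u|^2=\lambda\Big\}.$$ Then for every $\lambda>0$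 the energy $\mathcal E$ is bounded from below on the set of operators that are admissible in $J(\lambda)$, and, if $N$ is the smallest integer with $N\ge\lambda$, $$J(\lambda)=\inf\Big\{\mathcal E(\gamma):\ \gamma=\sum_{i=1}^{N-1}|u_i\rangle\langle u_i|+(\lambda-N+1)|u_N\rangle\langle u_N|,\ u_1,\dots,u_N\in H^1(\mathbb R^d)\text{ orthonormal in }L^2(\mathbb R^d)\Big\}.$$ In particular: (i) for every integer $N\ge0$, $$J(N)=\inf\Big\{\sum_{n=1}^N\int_{\mathbb R^d}|\nabla u_n|^2-\frac1p\int_{\mathbb R^d}\Big(\sum_{n=1}^N|u_n|^2\Big)^p:\ u_1,\dots,u_N\in H^1(\mathbb R^d,\mathbb C),\ \langle u_j,u_k\rangle_{L^2}=\delta_{jk}\Big\};$$ (ii) for every $0\le\lambda\le1$, $$J(\lambda)=I(\lambda)=I(1)\,\lambda^{1+\frac2d\frac{p-1}{1+\frac2d-p}} .$$ -/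

import Mathlib

noncomputable section

namespace NLSRelaxation

/-- The Hilbert space `L²(ℝᵈ, ℂ)`. -/
abbrev L2 (d : ℕ) : Type :=
  MeasureTheory.Lp ℂ 2 (MeasureTheory.volume : MeasureTheory.Measure (EuclideanSpace ℝ (Fin d)))

/-- `g = (g₁, …, g_d) ∈ L²(ℝᵈ)ᵈ` is the weak gradient of `u ∈ L²(ℝᵈ)`: for every `j`, the
distributional derivative `∂ⱼu` is (the distribution associated with) `gⱼ`. -/
def IsWeakGradient {d : ℕ} (u : L2 d) (g : Fin d → L2 d) : Prop :=
  ∀ j : Fin d,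
    LineDeriv.lineDerivOp (EuclideanSpace.single j (1 : ℝ))
        (MeasureTheory.Lp.toTemperedDistribution u) =
      MeasureTheory.Lp.toTemperedDistribution (g j)

/-- `u ∈ H¹(ℝᵈ, ℂ)`. -/
def MemH1 {d : ℕ} (u : L2 d) : Prop :=
  ∃ g : Fin d → L2 d, IsWeakGradient u g

/-- `∫ |∇u|² ∈ [0, ∞]`. The weak gradient is unique if it exists, so the infimum is over one
element at most; it is `∞` if `u ∉ H¹(ℝᵈ)`. -/
def dirichlet {d : ℕ} (u : L2 d) : ENNReal :=
  ⨅ (g : Fin d → L2 d) (_ : IsWeakGradient u g), ∑ j : Fin d, ‖g j‖ₑ ^ 2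

/-- `K - (1/p) ∫ ρᵖ`, the energy of a state with kinetic energy `K` and density `ρ`.
It is only used for `K < ∞`. -/
def energyOf {d : ℕ} (p : ℝ) (K : ENNReal) (ρ : EuclideanSpace ℝ (Fin d) → ENNReal) : EReal :=
  (K : EReal) - ((ENNReal.ofReal (1 / p) * ∫⁻ x, ρ x ^ p : ENNReal) : EReal)

/-! ### The problem for one function -/

/-- The NLS energy `∫ |∇u|² - (1/p) ∫ |u|²ᵖ` of one function. -/
def nlsEnergy {d : ℕ} (p : ℝ) (u : L2 d) : EReal :=
  energyOf p (dirichlet u) (fun x => ‖u x‖ₑ ^ 2)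

/-- `I(λ)`, the infimum of the NLS energy over `u ∈ H¹(ℝᵈ)` with `∫ |u|² = λ`. -/
def I (d : ℕ) (p lam : ℝ) : EReal :=
  ⨅ (u : L2 d) (_ : MemH1 u ∧ ‖u‖ ^ 2 = lam), nlsEnergy p u

/-! ### The problem for orthonormal functions -/

/-- `∑ₙ ∫ |∇uₙ|² - (1/p) ∫ (∑ₙ |uₙ|²)ᵖ`. -/
def systemEnergy {d N : ℕ} (p : ℝ) (u : Fin N → L2 d) : EReal :=
  energyOf p (∑ i, dirichlet (u i)) (fun x => ∑ i, ‖u i x‖ₑ ^ 2)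

/-- The infimum of the energy over `u₁, …, u_N ∈ H¹(ℝᵈ)`, orthonormal in `L²(ℝᵈ)`. -/
def orthonormalInf (d : ℕ) (p : ℝ) (N : ℕ) : EReal :=
  ⨅ (u : Fin N → L2 d) (_ : (∀ i, MemH1 (u i)) ∧ Orthonormal ℂ u), systemEnergy p u

/-! ### The relaxed problem for density matrices -/

/-- The trace `∑ₖ ⟨eₖ, γ eₖ⟩ ∈ [0, ∞]` of a nonnegative operator, where `(eₖ)` is a Hilbert basis;
it does not depend on the basis. -/
def trace {d : ℕ} (γ : L2 d →L[ℂ] L2 d) : ENNReal :=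
  let b := (exists_hilbertBasis ℂ (L2 d)).choose_spec.choose
  ∑' k, ENNReal.ofReal (inner ℂ (b k) (γ (b k))).re

/-- `γ = ∑ᵢ nᵢ |uᵢ⟩⟨uᵢ|` with `nᵢ ≥ 0` and an orthonormal sequence `(uᵢ)`. For `γ` of finite rank
all but finitely many `nᵢ` vanish. -/
structure IsDiagonalisation {d : ℕ} (γ : L2 d →L[ℂ] L2 d) (n : ℕ → ℝ) (u : ℕ → L2 d) : Prop where
  nonneg : ∀ i, 0 ≤ n i
  orthonormal : Orthonormal ℂ u
  hasSum : ∀ f : L2 d, HasSum (fun i => (n i : ℂ) • InnerProductSpace.rankOne ℂ (u i) (u i) f) (γ f)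

open Classical in
/-- A diagonalisation `(n, u)` of `γ`. One exists for every nonnegative operator of finite trace in
dimension `d ≥ 1`, by the spectral theorem; the value `(0, 0)` otherwise is never used. -/
def diagonalisation {d : ℕ} (γ : L2 d →L[ℂ] L2 d) : (ℕ → ℝ) × (ℕ → L2 d) :=
  if h : ∃ nu : (ℕ → ℝ) × (ℕ → L2 d), IsDiagonalisation γ nu.1 nu.2 then h.choose else (0, 0)

/-- `Tr(-Δγ) = ∑ᵢ nᵢ ∫ |∇uᵢ|² ∈ [0, ∞]`; it does not depend on the diagonalisation. -/
def kineticEnergy {d : ℕ} (γ : L2 d →L[ℂ] L2 d) : ENNReal :=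
  ∑' i, ENNReal.ofReal ((diagonalisation γ).1 i) * dirichlet ((diagonalisation γ).2 i)

/-- The density `ρ_γ = ∑ᵢ nᵢ |uᵢ|²`; up to null sets it does not depend on the diagonalisation. -/
def density {d : ℕ} (γ : L2 d →L[ℂ] L2 d) (x : EuclideanSpace ℝ (Fin d)) : ENNReal :=
  ∑' i, ENNReal.ofReal ((diagonalisation γ).1 i) * ‖(diagonalisation γ).2 i x‖ₑ ^ 2

/-- `ℰ(γ) = Tr(-Δγ) - (1/p) ∫ ρ_γᵖ`. -/
def energy {d : ℕ} (p : ℝ) (γ : L2 d →L[ℂ] L2 d) : EReal :=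
  energyOf p (kineticEnergy γ) (density γ)

/-- `0 ≤ γ = γ* ≤ 1` (as operators), `Tr γ = λ` and `Tr(-Δγ) < ∞`. -/
structure Admissible {d : ℕ} (lam : ℝ) (γ : L2 d →L[ℂ] L2 d) : Prop where
  isPositive : γ.IsPositive
  le_one : γ ≤ 1
  trace_eq : trace γ = ENNReal.ofReal lam
  kinetic_lt_top : kineticEnergy γ < ⊤

/-- `J(λ)`, the infimum of `ℰ` over the admissible density matrices of trace `λ`. -/
def J (d : ℕ) (p lam : ℝ) : EReal :=
  ⨅ (γ : L2 d →L[ℂ] L2 d) (_ : Admissible lam γ), energy p γ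

/-- `γ = ∑_{i=1}^{N-1} |uᵢ⟩⟨uᵢ| + (λ - N + 1) |u_N⟩⟨u_N|`. -/
def finiteRankOperator {d N : ℕ} (lam : ℝ) (u : Fin N → L2 d) : L2 d →L[ℂ] L2 d :=
  ∑ i : Fin N,
    (((if (i : ℕ) + 1 = N then lam - N + 1 else 1 : ℝ)) : ℂ) •
      InnerProductSpace.rankOne ℂ (u i) (u i)

/-- The infimum of `ℰ(γ)` over `γ = ∑_{i=1}^{N-1} |uᵢ⟩⟨uᵢ| + (λ - N + 1) |u_N⟩⟨u_N|` with
`u₁, …, u_N ∈ H¹(ℝᵈ)` orthonormal in `L²(ℝᵈ)`. -/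
def finiteRankInf (d : ℕ) (p : ℝ) (N : ℕ) (lam : ℝ) : EReal :=
  ⨅ (u : Fin N → L2 d) (_ : (∀ i, MemH1 (u i)) ∧ Orthonormal ℂ u),
    energy p (finiteRankOperator lam u)

end NLSRelaxation

end

/-!
Three facts carry the theorem.

*The energy can be read off any diagonalisation.* For `γ = ∑ nᵢ |uᵢ⟩⟨uᵢ|`, a unitary `U` and a
measurable set `A`, the integral over `A` of `∑ nᵢ |U uᵢ|²` is the trace of the operator
`1_A U γ U* 1_A`, hence depends on `γ` only (`IsDiagonalisation.setLIntegral_density`). Taking `U = 1`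
this determines the density, and taking for `U` the Fourier transform it determines the kinetic
energy, because `∫ |∇u|² = ∫ 4π²|ξ|² |û|²` (`dirichlet_eq`). A diagonalisation exists, since a
positive operator of finite trace is the square of a Hilbert–Schmidt operator and so is compact
(`exists_isDiagonalisation`).

*Minimisation over the occupation numbers.* For fixed orbitals `uᵢ` the kinetic energy is linear in
the occupation numbers `nᵢ` and `-∫ ρᵖ` is concave. First, the charge of the tail `i ≥ M` is moved to
one orbital of that tail whose kinetic energy is at most the average over the tail; this does not
raise the kinetic energy, and the density that is lost is negligible as `M → ∞` by monotone
convergence (`finiteRankInf_le_of_tail`, `finiteRankInf_le`). Once finitely many orbitals are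
occupied, charge is moved between two fractionally occupied orbitals: by concavity one of the two
directions does not raise the energy, and the move may be continued until an orbital is empty or full
(`exists_fewer_fractional`). In the end at most one orbital is fractionally occupied
(`exists_extremal`), and since the occupation numbers add up to `λ`, there are `N - 1` full orbitals
and one with the occupation number `λ - N + 1`. This is `J_eq_finiteRankInf`; for integer `λ` the last
occupation number is `1`, and for `0 < λ ≤ 1` only `λ |u⟩⟨u|` remains, the one-function problem for
`√λ u`. The power law for `I` comes from the substitution `u ↦ c u(a ·)`, with `c` and `a` chosen such
that both terms of the energy are multiplied by the same factor (`I_le_I_mul`).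

*Boundedness from below.* The density is split, at a level `τ` that varies, into the contributions of
low frequencies `B|ξ|ᵈ ≤ τ` and of high frequencies. Functions with Fourier transform in a set of
finite volume are bounded, so for suitable `B` the low frequencies alone cannot produce a density
above `τ`, and by Markov's inequality the measure of `{ρ > τ}` is at most `4/τ` times the mass of the
momentum density `ρ̂ = ∑ nᵢ |ûᵢ|²` in `{B|ξ|ᵈ > τ}` (`measure_density_gt_le`). Integration over `τ`
gives `∫ ρᵖ ≤ C ∫ |ξ|^(d(p - 1)) ρ̂`. As `d(p - 1) < 2`, this is bounded by a constant plus a small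
multiple of `∫ |ξ|² ρ̂`, that is, of the kinetic energy (`exists_lintegral_density_rpow_le`).
-/

noncomputable section

/-! ### Compact positive operators and Hilbert bases of eigenvectors -/

section

open MeasureTheory ENNReal Filter Topology

section Hilbert

variable {H : Type*} [NormedAddCommGroup H] [InnerProductSpace ℂ H]

/-- The operator norm is bounded by the Hilbert–Schmidt norm. -/
theorem norm_sum_rankOne_sq_le {κ : Type*} {e : κ → H} (he : Orthonormal ℂ e) (y : κ → H)
    (t : Finset κ) :
    ‖∑ k ∈ t, InnerProductSpace.rankOne ℂ (y k) (e k)‖ ^ 2 ≤ ∑ k ∈ t, ‖y k‖ ^ 2 := by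
  have hnn : 0 ≤ ∑ k ∈ t, ‖y k‖ ^ 2 := Finset.sum_nonneg fun _ _ => by positivity
  have : ‖∑ k ∈ t, InnerProductSpace.rankOne ℂ (y k) (e k)‖ ≤ √(∑ k ∈ t, ‖y k‖ ^ 2) := by
    refine ContinuousLinearMap.opNorm_le_bound _ (Real.sqrt_nonneg _) fun x => ?_
    simp only [sum_apply, InnerProductSpace.rankOne_apply]
    have h1 : ‖∑ k ∈ t, inner ℂ (e k) x • y k‖ ≤ ∑ k ∈ t, ‖inner ℂ (e k) x‖ * ‖y k‖ :=
      (norm_sum_le _ _).trans (Finset.sum_le_sum fun k _ => (norm_smul _ _).le)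
    have h2 := Finset.sum_mul_sq_le_sq_mul_sq t (fun k => ‖inner ℂ (e k) x‖) (fun k => ‖y k‖)
    have h3 := he.sum_inner_products_le x (s := t)
    have h4 : (∑ k ∈ t, ‖inner ℂ (e k) x‖ * ‖y k‖) ^ 2 ≤
        (√(∑ k ∈ t, ‖y k‖ ^ 2) * ‖x‖) ^ 2 := by
      rw [mul_pow, Real.sq_sqrt hnn]
      nlinarith
    exact h1.trans (le_of_sq_le_sq h4 (by positivity))
  calc _ ≤ (√(∑ k ∈ t, ‖y k‖ ^ 2)) ^ 2 := by gcongr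
    _ = _ := Real.sq_sqrt hnn

theorem isCompactOperator_rankOne (x y : H) :
    IsCompactOperator (InnerProductSpace.rankOne ℂ x y : H →L[ℂ] H) := by
  rw [InnerProductSpace.rankOne_def']
  have h : IsCompactOperator (ContinuousLinearMap.toSpanSingleton ℂ x : ℂ → H) :=
    isCompactOperator_of_locallyCompactSpace_rng (ContinuousLinearMap.toSpanSingleton ℂ x)
  exact h.comp_clm _

/-- Hilbert–Schmidt operators are compact. -/
theorem isCompactOperator_of_summable_norm_sq [CompleteSpace H] {κ : Type*}
    (b : HilbertBasis κ ℂ H) (T : H →L[ℂ] H) (hT : Summable fun k => ‖T (b k)‖ ^ 2) :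
    IsCompactOperator T := by
  have hs : Summable fun k => (InnerProductSpace.rankOne ℂ (T (b k)) (b k) : H →L[ℂ] H) := by
    rw [summable_iff_vanishing_norm]
    intro ε hε
    obtain ⟨s, hs⟩ := summable_iff_vanishing_norm.1 hT (ε ^ 2) (by positivity)
    refine ⟨s, fun t ht => ?_⟩
    have h1 := norm_sum_rankOne_sq_le b.orthonormal (fun k => T (b k)) t
    have h2 := hs t ht
    rw [Real.norm_eq_abs] at h2
    exact lt_of_pow_lt_pow_left₀ 2 hε.le (h1.trans_lt ((le_abs_self _).trans_lt h2))
  obtain ⟨S, hS⟩ := hs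
  have hST : S = T := by
    ext x
    have h1 : HasSum (fun k => b.repr x k • T (b k)) (S x) := by
      have := hS.mapL (ContinuousLinearMap.apply ℂ H x)
      simpa [HilbertBasis.repr_apply_apply] using this
    have h2 := (b.hasSum_repr x).mapL T
    simp only [map_smul] at h2
    exact h1.unique h2
  rw [← hST]
  refine isCompactOperator_of_tendsto hS (Eventually.of_forall fun s => ?_)
  induction s using Finset.cons_induction with
  | empty => simpa using isCompactOperator_zero
  | cons a s ha ih =>
    rw [Finset.sum_cons]
    exact (isCompactOperator_rankOne _ _).add ih

/-- A positive operator of finite trace is compact: its square root is Hilbert–Schmidt. -/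
theorem isCompactOperator_of_trace_lt_top [CompleteSpace H] {κ : Type*}
    (b : HilbertBasis κ ℂ H) {T : H →L[ℂ] H} (hT : T.IsPositive)
    (htr : ∑' k, ENNReal.ofReal (inner ℂ (b k) (T (b k))).re ≠ ⊤) :
    IsCompactOperator T := by
  have hT0 : 0 ≤ T := (ContinuousLinearMap.nonneg_iff_isPositive T).2 hT
  set S := CFC.sqrt T with hSdef
  have hSS : S * S = T := CFC.sqrt_mul_sqrt_self T hT0
  have hSpos : S.IsPositive := (ContinuousLinearMap.nonneg_iff_isPositive S).1 (CFC.sqrt_nonneg T)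
  have hnorm : ∀ x, (inner ℂ x (T x)).re = ‖S x‖ ^ 2 := fun x => by
    rw [← hSS, mul_apply_eq_comp, ← hSpos.inner_left_eq_inner_right]
    rw [inner_self_eq_norm_sq_to_K]
    norm_cast
  have hS : IsCompactOperator S := by
    refine isCompactOperator_of_summable_norm_sq b S ?_
    have := ENNReal.summable_toReal htr
    refine this.congr fun k => ?_
    rw [hnorm, ENNReal.toReal_ofReal (by positivity)]
  rw [← hSS]
  exact hS.comp_clm S

/-- Parseval's identity. -/
theorem HilbertBasis.tsum_enorm_inner_sq {κ : Type*} (b : HilbertBasis κ ℂ H) (f : H) :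
    ∑' k, ‖inner ℂ (b k) f‖ₑ ^ 2 = ‖f‖ₑ ^ 2 := by
  have h := b.hasSum_inner_mul_inner f f
  have h2 : HasSum (fun k => ‖inner ℂ (b k) f‖ ^ 2) (‖f‖ ^ 2) := by
    have h3 := Complex.hasSum_re h
    convert h3 using 1
    · ext k
      rw [← inner_conj_symm f (b k), Complex.conj_mul']
      norm_cast
    · rw [inner_self_eq_norm_sq_to_K]; norm_cast
  have h3 := ENNReal.ofReal_tsum_of_nonneg (fun k => by positivity) h2.summable
  rw [h2.tsum_eq] at h3
  simp only [ENNReal.ofReal_pow (norm_nonneg _), ofReal_norm] at h3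
  exact h3.symm

/-- An orthogonal family of closed subspaces with dense span has an adapted Hilbert basis. -/
theorem exists_hilbertBasis_of_orthogonalFamily [CompleteSpace H] (V : ℂ → Submodule ℂ H)
    (hcl : ∀ μ, IsClosed (V μ : Set H))
    (hV : OrthogonalFamily ℂ (fun μ => V μ) fun μ => (V μ).subtypeₗᵢ)
    (hbot : (⨆ μ, V μ)ᗮ = ⊥) :
    ∃ (s : Set H) (b : HilbertBasis s ℂ H), ∀ k, ∃ μ, b k ∈ V μ := by
  have (μ : ℂ) : CompleteSpace (V μ) := (hcl μ).completeSpace_coe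
  choose w e he using fun μ => exists_hilbertBasis ℂ (V μ)
  have horth : Orthonormal ℂ (fun a : Σ μ, w μ => ((e a.1 a.2 : V a.1) : H)) :=
    hV.orthonormal_sigma_orthonormal (fun μ => (e μ).orthonormal)
  have hs := horth.toSubtypeRange
  have hbot' : (Submodule.span ℂ (Set.range (Subtype.val :
      Set.range (fun a : Σ μ, w μ => ((e a.1 a.2 : V a.1) : H)) → H)))ᗮ = ⊥ := by
    rw [Subtype.range_coe, eq_bot_iff, ← hbot]
    intro x hx
    rw [Submodule.mem_orthogonal] at hx ⊢
    have hle : ∀ μ, V μ ≤ (Submodule.span ℂ {x})ᗮ := by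
      intro μ y hy
      have h1 := (e μ).hasSum_repr ⟨y, hy⟩
      have h2 := (h1.mapL (V μ).subtypeL).mapL (innerSL ℂ x)
      have h3 : (fun i => innerSL ℂ x ((V μ).subtypeL ((e μ).repr ⟨y, hy⟩ i • e μ i))) =
          fun _ => 0 := by
        ext i
        have := hx _ (Submodule.subset_span ⟨⟨μ, i⟩, rfl⟩)
        simp only [map_smul, Submodule.subtypeL_apply, innerSL_apply_apply, smul_eq_mul]
        rw [← inner_conj_symm, this]; simp
      rw [h3] at h2
      have h4 := h2.unique hasSum_zero
      rw [Submodule.mem_orthogonal_singleton_iff_inner_right]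
      simpa using h4
    intro u hu
    have := Submodule.mem_orthogonal_singleton_iff_inner_right.1 (iSup_le hle hu)
    rw [← inner_conj_symm, this]; simp
  refine ⟨_, HilbertBasis.mkOfOrthogonalEqBot hs hbot', fun k => ?_⟩
  rw [HilbertBasis.coe_mkOfOrthogonalEqBot]
  obtain ⟨_, a, rfl⟩ := k
  exact ⟨a.1, (e a.1 a.2).2⟩

/-- A compact self-adjoint operator has a Hilbert basis of eigenvectors. -/
theorem exists_hilbertBasis_eigenvectors [CompleteSpace H] {T : H →L[ℂ] H}
    (hc : IsCompactOperator T) (hs : T.IsSymmetric) :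
    ∃ (s : Set H) (b : HilbertBasis s ℂ H) (μ : s → ℂ), ∀ k, T (b k) = μ k • b k := by
  obtain ⟨s, b, hb⟩ := exists_hilbertBasis_of_orthogonalFamily
    (fun μ => Module.End.eigenspace (T : Module.End ℂ H) μ)
    (fun μ => by
      have : (Module.End.eigenspace (T : Module.End ℂ H) μ : Set H) = {x | T x = μ • x} :=
        Set.ext fun x => Module.End.mem_eigenspace_iff
      rw [this]
      exact isClosed_eq T.continuous (continuous_const_smul μ))
    hs.orthogonalFamily_eigenspaces
    (ContinuousLinearMap.orthogonalComplement_iSup_eigenspaces_eq_bot hc hs)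
  choose μ hμ using hb
  exact ⟨s, b, μ, fun k => Module.End.mem_eigenspace_iff.1 (hμ k)⟩

/-- Every Hilbert basis of a separable infinite-dimensional space can be indexed by `ℕ`. -/
theorem HilbertBasis.nonempty_equiv_nat [SecondCountableTopology H]
    (hinf : ¬ FiniteDimensional ℂ H) {κ : Type*} (b : HilbertBasis κ ℂ H) : Nonempty (κ ≃ ℕ) := by
  have hcount : Countable κ := by
    have hdist : Pairwise fun i j => (1:ℝ) ≤ dist (b i) (b j) := by
      intro i j hij
      have h1 : ‖b i - b j‖ ^ 2 = 2 := by
        rw [@norm_sub_sq ℂ, b.orthonormal.1 i, b.orthonormal.1 j, b.orthonormal.2 hij]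
        norm_num
      rw [dist_eq_norm]
      nlinarith [norm_nonneg (b i - b j)]
    have hdisj : Pairwise (Function.onFun Disjoint fun i => Metric.ball (b i) (1/2)) := by
      intro i j hij
      exact Metric.ball_disjoint_ball (by linarith [hdist hij])
    have : TopologicalSpace.SeparableSpace H := inferInstance
    exact Pairwise.countable_of_isOpen_disjoint hdisj (fun _ => Metric.isOpen_ball)
      (fun i => ⟨b i, by simp⟩)
  have hinfκ : Infinite κ := by
    by_contra hfin
    rw [not_infinite_iff_finite] at hfin
    have := Fintype.ofFinite κ
    exact hinf (Module.Basis.finiteDimensional_of_finite b.toOrthonormalBasis.toBasis)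
  exact nonempty_equiv_of_countable

end Hilbert

end

/-! ### Diagonalisations of operators on `L²(ℝᵈ)` -/

section

open MeasureTheory ENNReal Filter Topology
open scoped ComplexOrder

namespace NLSRelaxation

variable {d : ℕ}

namespace IsDiagonalisation

variable {γ : L2 d →L[ℂ] L2 d} {n : ℕ → ℝ} {u : ℕ → L2 d}

theorem hasSum_inner (h : IsDiagonalisation γ n u) (f : L2 d) :
    HasSum (fun i => ((n i * ‖inner ℂ (u i) f‖ ^ 2 : ℝ) : ℂ)) (inner ℂ f (γ f)) := by
  have h1 := (h.hasSum f).mapL (innerSL ℂ f)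
  have h2 : (fun i => ((n i * ‖inner ℂ (u i) f‖ ^ 2 : ℝ) : ℂ)) = fun i =>
      innerSL ℂ f ((n i : ℂ) • InnerProductSpace.rankOne ℂ (u i) (u i) f) := by
    ext1 i
    simp only [innerSL_apply_apply, InnerProductSpace.rankOne_apply, inner_smul_right]
    rw [← inner_conj_symm f (u i), Complex.mul_conj']
    push_cast
    ring
  rw [h2]
  exact h1

theorem hasSum_re_inner (h : IsDiagonalisation γ n u) (f : L2 d) :
    HasSum (fun i => n i * ‖inner ℂ (u i) f‖ ^ 2) (inner ℂ f (γ f)).re :=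
  Complex.hasSum_re (h.hasSum_inner f)

theorem re_inner_nonneg (h : IsDiagonalisation γ n u) (f : L2 d) : 0 ≤ (inner ℂ f (γ f)).re :=
  (h.hasSum_re_inner f).nonneg fun i => mul_nonneg (h.nonneg i) (by positivity)

/-- The quadratic form of `γ` in terms of a diagonalisation. -/
theorem ofReal_re_inner (h : IsDiagonalisation γ n u) (f : L2 d) :
    ENNReal.ofReal (inner ℂ f (γ f)).re =
      ∑' i, ENNReal.ofReal (n i) * ‖inner ℂ (u i) f‖ₑ ^ 2 := by
  have h1 := h.hasSum_re_inner f
  rw [← h1.tsum_eq, ENNReal.ofReal_tsum_of_nonneg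
    (fun i => mul_nonneg (h.nonneg i) (by positivity)) h1.summable]
  congr 1
  ext i
  rw [ENNReal.ofReal_mul (h.nonneg i), ENNReal.ofReal_pow (norm_nonneg _), ofReal_norm]

theorem enorm_eq_one (h : IsDiagonalisation γ n u) (i : ℕ) : ‖u i‖ₑ = 1 := by
  rw [← ofReal_norm, h.orthonormal.1 i, ENNReal.ofReal_one]

theorem trace_eq (h : IsDiagonalisation γ n u) :
    trace γ = ∑' i, ENNReal.ofReal (n i) := by
  unfold trace
  simp only [h.ofReal_re_inner]
  rw [ENNReal.tsum_comm]
  congr 1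
  ext i
  rw [ENNReal.tsum_mul_left]
  simp_rw [← RCLike.enorm_conj (inner ℂ (u i) _), inner_conj_symm]
  rw [HilbertBasis.tsum_enorm_inner_sq, h.enorm_eq_one]
  simp

theorem re_inner_self (h : IsDiagonalisation γ n u) (i : ℕ) :
    (inner ℂ (u i) (γ (u i))).re = n i := by
  have h1 := h.hasSum_re_inner (u i)
  have h2 : HasSum (fun j => n j * ‖inner ℂ (u j) (u i)‖ ^ 2) (n i) := by
    convert hasSum_ite_eq i (n i) using 1
    ext j
    rw [orthonormal_iff_ite.1 h.orthonormal j i]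
    by_cases hji : j = i
    · simp [hji]
    · simp [hji]
  exact h1.unique h2

theorem le_one_of_le_one (h : IsDiagonalisation γ n u) (hγ : γ ≤ 1) (i : ℕ) : n i ≤ 1 := by
  have h1 := ((ContinuousLinearMap.le_def _ _).1 hγ).re_inner_nonneg_right (u i)
  rw [sub_apply, one_apply_eq_self, inner_sub_right,
    map_sub, inner_self_eq_norm_sq, h.orthonormal.1 i] at h1
  have h2 := h.re_inner_self i
  simp only [RCLike.re_eq_complex_re] at h1
  linarith

theorem im_inner (h : IsDiagonalisation γ n u) (f : L2 d) : (inner ℂ f (γ f)).im = 0 := by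
  have h1 := Complex.hasSum_im (h.hasSum_inner f)
  simp only [Complex.ofReal_im] at h1
  exact h1.unique hasSum_zero

theorem isPositive (h : IsDiagonalisation γ n u) : γ.IsPositive := by
  rw [ContinuousLinearMap.isPositive_iff_complex]
  intro f
  have h1 : inner ℂ (γ f) f = (((inner ℂ f (γ f)).re : ℝ) : ℂ) := by
    rw [← inner_conj_symm (γ f) f]
    apply Complex.ext
    · rw [Complex.conj_re, Complex.ofReal_re]
    · rw [Complex.conj_im, Complex.ofReal_im, h.im_inner f, neg_zero]
  rw [h1]
  exact ⟨rfl, h.re_inner_nonneg f⟩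

theorem le_one (h : IsDiagonalisation γ n u) (hn : ∀ i, n i ≤ 1) : γ ≤ 1 := by
  rw [ContinuousLinearMap.le_def, ContinuousLinearMap.isPositive_iff_complex]
  intro f
  have h0 : inner ℂ (γ f) f = (((inner ℂ f (γ f)).re : ℝ) : ℂ) := by
    rw [← inner_conj_symm (γ f) f]
    apply Complex.ext
    · rw [Complex.conj_re, Complex.ofReal_re]
    · rw [Complex.conj_im, Complex.ofReal_im, h.im_inner f, neg_zero]
  have h2 : inner ℂ f f = ((‖f‖ ^ 2 : ℝ) : ℂ) := by
    rw [inner_self_eq_norm_sq_to_K]; norm_cast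
  have h1 : inner ℂ ((1 - γ) f) f = ((‖f‖ ^ 2 - (inner ℂ f (γ f)).re : ℝ) : ℂ) := by
    rw [sub_apply, one_apply_eq_self, inner_sub_left, h0, h2]
    push_cast; rfl
  have h3 : (inner ℂ f (γ f)).re ≤ ‖f‖ ^ 2 := by
    have hs := h.hasSum_re_inner f
    have hb := h.orthonormal.inner_products_summable f
    calc _ ≤ ∑' i, ‖inner ℂ (u i) f‖ ^ 2 := by
          rw [← hs.tsum_eq]
          refine hs.summable.tsum_le_tsum (fun i => ?_) hb
          exact mul_le_of_le_one_left (by positivity) (hn i)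
      _ ≤ _ := h.orthonormal.tsum_inner_products_le f
  rw [h1]
  exact ⟨rfl, sub_nonneg.2 h3⟩

end IsDiagonalisation

instance : SecondCountableTopology (L2 d) :=
  have : Fact ((2 : ENNReal) ≠ ⊤) := ⟨by norm_num⟩
  Lp.SecondCountableTopology

/-- The indicators of disjoint unit balls span an infinite-dimensional subspace. -/
theorem not_finiteDimensional_L2 (hd : 1 ≤ d) : ¬ FiniteDimensional ℂ (L2 d) := by
  intro hfin
  set c : ℕ → EuclideanSpace ℝ (Fin d) := fun k => EuclideanSpace.single ⟨0, hd⟩ (2 * k : ℝ) with hc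
  have hdisj : ∀ i j : ℕ, i ≠ j → Disjoint (Metric.ball (c i) 1) (Metric.ball (c j) 1) := by
    intro i j hij
    refine Metric.ball_disjoint_ball ?_
    rw [hc, PiLp.dist_single_same, Real.dist_eq]
    have h1 : (1 : ℝ) ≤ |(i : ℝ) - j| := by
      have : (1 : ℤ) ≤ |(i : ℤ) - j| := Int.one_le_abs (by omega)
      exact_mod_cast this
    rw [← mul_sub, abs_mul]
    norm_num
    linarith
  set v : ℕ → L2 d := fun k => indicatorConstLp 2 (μ := volume)
    (Metric.isOpen_ball (x := c k) (ε := 1)).measurableSet measure_ball_lt_top.ne (1 : ℂ) with hv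
  have hind : LinearIndependent ℂ v := by
    refine linearIndependent_of_ne_zero_of_inner_eq_zero (fun k hk => ?_) (fun i j hij => ?_)
    · have h1 : ‖v k‖ = 0 := by rw [hk, norm_zero]
      rw [hv, norm_indicatorConstLp (by norm_num) (by norm_num)] at h1
      have h2 : 0 < volume.real (Metric.ball (c k) 1) :=
        ENNReal.toReal_pos (Metric.measure_ball_pos _ _ one_pos).ne' measure_ball_lt_top.ne
      have h3 := Real.rpow_pos_of_pos h2 (1 / (2 : ENNReal).toReal)
      simp only [norm_one, one_mul] at h1
      exact h3.ne' h1
    · change inner ℂ (v i) (v j) = 0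
      rw [L2.inner_indicatorConstLp_indicatorConstLp]
      simp [(hdisj i j hij).inter_eq]
  -- in a finite-dimensional space a linearly independent family has a finite index type
  have := hind.finite
  exact not_finite ℕ

/-- A positive operator of finite trace on `L²(ℝᵈ)` has a diagonalisation. -/
theorem exists_isDiagonalisation (hd : 1 ≤ d) {γ : L2 d →L[ℂ] L2 d} (hpos : γ.IsPositive)
    (htr : trace γ ≠ ⊤) : ∃ n u, IsDiagonalisation γ n u := by
  have hc := isCompactOperator_of_trace_lt_top _ hpos htr
  obtain ⟨s, b, μ, hμ⟩ := exists_hilbertBasis_eigenvectors hc hpos.isSymmetric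
  obtain ⟨e⟩ := b.nonempty_equiv_nat (not_finiteDimensional_L2 hd)
  have hμ' : ∀ k, 0 ≤ μ k := by
    intro k
    have := hpos.inner_nonneg_right (b k)
    rw [hμ, inner_smul_right, inner_self_eq_norm_sq_to_K, b.orthonormal.1 k] at this
    simpa using this
  have hμr : ∀ k, ((μ k).re : ℂ) = μ k := fun k => (Complex.eq_re_of_ofReal_le (hμ' k)).symm
  refine ⟨fun i => (μ (e.symm i)).re, fun i => b (e.symm i),
    ⟨fun i => (Complex.le_def.1 (hμ' _)).1, b.orthonormal.comp _ e.symm.injective, fun f => ?_⟩⟩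
  have h1 := (b.hasSum_repr f).mapL γ
  rw [← e.symm.hasSum_iff] at h1
  convert h1 using 1
  ext1 i
  simp only [hμr, InnerProductSpace.rankOne_apply, Function.comp_apply, map_smul, hμ,
    HilbertBasis.repr_apply_apply]
  rw [smul_comm]

theorem isDiagonalisation_diagonalisation {γ : L2 d →L[ℂ] L2 d}
    (h : ∃ n u, IsDiagonalisation γ n u) :
    IsDiagonalisation γ (diagonalisation γ).1 (diagonalisation γ).2 := by
  obtain ⟨n, u, h⟩ := h
  have h' : ∃ nu : (ℕ → ℝ) × (ℕ → L2 d), IsDiagonalisation γ nu.1 nu.2 := ⟨(n, u), h⟩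
  unfold diagonalisation
  rw [dif_pos h']
  exact h'.choose_spec

/-- An orthonormal family extends to an orthonormal sequence. -/
theorem exists_orthonormal_extension (hd : 1 ≤ d) {ι : Type*} {u : ι → L2 d}
    (hu : Orthonormal ℂ u) :
    ∃ (v : ℕ → L2 d) (φ : ι → ℕ), Orthonormal ℂ v ∧ φ.Injective ∧ ∀ i, v (φ i) = u i := by
  obtain ⟨w, b, hw, hb⟩ := hu.toSubtypeRange.exists_hilbertBasis_extension
  obtain ⟨e⟩ := b.nonempty_equiv_nat (not_finiteDimensional_L2 hd)
  refine ⟨fun k => b (e.symm k), fun i => e ⟨u i, hw ⟨i, rfl⟩⟩,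
    b.orthonormal.comp _ e.symm.injective, fun i j hij => ?_, fun i => by simp [hb]⟩
  exact hu.linearIndependent.injective (Subtype.ext_iff.1 (e.injective hij))

/-- Sums against occupation numbers that are extended by zero to all of `ℕ`. -/
theorem tsum_extend_mul {ι : Type*} [Fintype ι] {φ : ι → ℕ} (hφ : φ.Injective) (w : ι → ℝ)
    (F : ℕ → ENNReal) :
    ∑' k, ENNReal.ofReal (Function.extend φ w 0 k) * F k =
      ∑ i, ENNReal.ofReal (w i) * F (φ i) := by
  rw [← tsum_fintype (L := .unconditional _), ← hφ.tsum_eq]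
  · simp [hφ.extend_apply]
  · intro k hk
    by_contra hk'
    rw [Function.mem_support, Function.extend_apply' _ _ _ (by simpa using hk')] at hk
    simp at hk

/-- A finite combination of projections onto orthonormal vectors is diagonalised by any
orthonormal sequence extending these vectors. -/
theorem isDiagonalisation_sum {ι : Type*} [Fintype ι] {w : ι → ℝ} (hw : ∀ i, 0 ≤ w i)
    {u : ι → L2 d} {v : ℕ → L2 d} {φ : ι → ℕ} (hv : Orthonormal ℂ v) (hφ : φ.Injective)
    (hvu : ∀ i, v (φ i) = u i) :
    IsDiagonalisation (∑ i, (w i : ℂ) • InnerProductSpace.rankOne ℂ (u i) (u i))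
      (Function.extend φ w 0) v := by
  refine ⟨fun k => ?_, hv, fun f => ?_⟩
  · by_cases hk : ∃ i, φ i = k
    · obtain ⟨i, rfl⟩ := hk
      rw [hφ.extend_apply]; exact hw i
    · rw [Function.extend_apply' _ _ _ hk]; rfl
  · rw [← hφ.hasSum_iff]
    · have h1 : (fun k => ((Function.extend φ w 0 k : ℝ) : ℂ) •
          InnerProductSpace.rankOne ℂ (v k) (v k) f) ∘ φ =
          fun i => (w i : ℂ) • InnerProductSpace.rankOne ℂ (u i) (u i) f := by
        ext1 i
        simp [hφ.extend_apply, hvu]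
      rw [h1, sum_apply]
      exact hasSum_fintype _
    · intro k hk
      rw [Function.extend_apply' _ _ _ (by simpa using hk)]
      simp

end NLSRelaxation

end

/-! ### The density and the weak derivative, in position and Fourier space -/

section

open MeasureTheory ENNReal Filter Topology FourierTransform

namespace NLSRelaxation

variable {d : ℕ}

theorem enorm_sq_eq_lintegral (u : L2 d) : ‖u‖ₑ ^ 2 = ∫⁻ x, ‖u x‖ₑ ^ 2 := by
  rw [Lp.enorm_def, eLpNorm_eq_lintegral_rpow_enorm_toReal (by norm_num) (by norm_num),
    ← ENNReal.rpow_natCast, ← ENNReal.rpow_mul]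
  norm_num

/-- The product of the indicator of `A` and `u`, as an element of `L²`. -/
def restrictTo (A : Set (EuclideanSpace ℝ (Fin d))) (hA : MeasurableSet A) (u : L2 d) : L2 d :=
  ((Lp.memLp u).indicator hA).toLp

variable {A : Set (EuclideanSpace ℝ (Fin d))} (hA : MeasurableSet A)

theorem coeFn_restrictTo (u : L2 d) : restrictTo A hA u =ᵐ[volume] A.indicator u :=
  MemLp.coeFn_toLp _

theorem enorm_restrictTo_sq (u : L2 d) : ‖restrictTo A hA u‖ₑ ^ 2 = ∫⁻ x in A, ‖u x‖ₑ ^ 2 := by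
  rw [enorm_sq_eq_lintegral, ← lintegral_indicator hA]
  refine lintegral_congr_ae ?_
  filter_upwards [coeFn_restrictTo hA u] with x hx
  rw [hx]
  by_cases h : x ∈ A <;> simp [h]

theorem inner_restrictTo_right (u v : L2 d) :
    inner ℂ u (restrictTo A hA v) = inner ℂ (restrictTo A hA u) v := by
  rw [L2.inner_def, L2.inner_def]
  refine integral_congr_ae ?_
  filter_upwards [coeFn_restrictTo hA u, coeFn_restrictTo hA v] with x hx hy
  rw [hx, hy]
  by_cases h : x ∈ A <;> simp [h]

theorem measurable_tsum_enorm_sq (n : ℕ → ENNReal) (u : ℕ → L2 d) :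
    Measurable fun x => ∑' i, n i * ‖u i x‖ₑ ^ 2 :=
  Measurable.tsum fun i =>
    ((Lp.stronglyMeasurable (u i)).enorm.pow_const 2).const_mul _

/-- The integral over `A` of the density, in position space or after a unitary transformation `U`,
is the trace of `1_A U γ U* 1_A`. The right side involves `γ` but not the diagonalisation. -/
theorem IsDiagonalisation.setLIntegral_density {γ : L2 d →L[ℂ] L2 d} {n : ℕ → ℝ} {u : ℕ → L2 d}
    (h : IsDiagonalisation γ n u) (U : L2 d ≃ₗᵢ[ℂ] L2 d) {κ : Type*}
    (b : HilbertBasis κ ℂ (L2 d)) :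
    ∫⁻ x in A, ∑' i, ENNReal.ofReal (n i) * ‖U (u i) x‖ₑ ^ 2 =
      ∑' k, ENNReal.ofReal (inner ℂ (U.symm (restrictTo A hA (b k)))
        (γ (U.symm (restrictTo A hA (b k))))).re := by
  rw [lintegral_tsum fun i =>
    (((Lp.stronglyMeasurable _).enorm.pow_const 2).const_mul _).aemeasurable]
  simp_rw [lintegral_const_mul _ ((Lp.stronglyMeasurable (U (u _))).enorm.pow_const 2),
    ← enorm_restrictTo_sq hA, h.ofReal_re_inner]
  rw [ENNReal.tsum_comm]
  congr 1
  ext i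
  rw [ENNReal.tsum_mul_left, ← b.tsum_enorm_inner_sq]
  congr 2
  ext k
  rw [inner_restrictTo_right, ← RCLike.enorm_conj, inner_conj_symm, ← U.inner_map_map (u i),
    U.apply_symm_apply]

/-- The density of `γ`, in position space or after a unitary transformation `U`, does not depend
on the diagonalisation. -/
theorem IsDiagonalisation.density_ae_eq {γ : L2 d →L[ℂ] L2 d} {n m : ℕ → ℝ} {u v : ℕ → L2 d}
    (h : IsDiagonalisation γ n u) (h' : IsDiagonalisation γ m v) (U : L2 d ≃ₗᵢ[ℂ] L2 d) :
    (fun x => ∑' i, ENNReal.ofReal (n i) * ‖U (u i) x‖ₑ ^ 2) =ᵐ[volume]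
      fun x => ∑' i, ENNReal.ofReal (m i) * ‖U (v i) x‖ₑ ^ 2 := by
  obtain ⟨s, b, -⟩ := exists_hilbertBasis ℂ (L2 d)
  refine ae_eq_of_forall_setLIntegral_eq_of_sigmaFinite (measurable_tsum_enorm_sq _ _)
    (measurable_tsum_enorm_sq _ _) fun A hA _ => ?_
  rw [h.setLIntegral_density hA U b, h'.setLIntegral_density hA U b]

/-- The symbol `4π²|ξ|²` of `-Δ`. -/
def symbol (ξ : EuclideanSpace ℝ (Fin d)) : ENNReal := ENNReal.ofReal (4 * Real.pi ^ 2 * ‖ξ‖ ^ 2)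

theorem measurable_symbol : Measurable (symbol (d := d)) := by
  unfold symbol; fun_prop

/-- In Fourier space, the `j`-th weak derivative is multiplication by `2πiξⱼ`. -/
theorem lineDerivOp_eq_iff (u g : L2 d) (j : Fin d) :
    LineDeriv.lineDerivOp (EuclideanSpace.single j (1 : ℝ)) (Lp.toTemperedDistribution u) =
      Lp.toTemperedDistribution g ↔
    ∀ᵐ ξ, (𝓕 g : L2 d) ξ = (2 * Real.pi * Complex.I * ξ j) * (𝓕 u : L2 d) ξ := by
  rw [← (FourierTransform.fourierEquiv ℂ
    (TemperedDistribution (EuclideanSpace ℝ (Fin d)) ℂ)).injective.eq_iff,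
    FourierTransform.fourierEquiv_apply, FourierTransform.fourierEquiv_apply]
  rw [TemperedDistribution.fourier_lineDerivOp_eq, Lp.fourier_toTemperedDistribution_eq,
    Lp.fourier_toTemperedDistribution_eq]
  have htg : (fun ξ : EuclideanSpace ℝ (Fin d) =>
    ((inner ℝ ξ (EuclideanSpace.single j (1 : ℝ)) : ℝ) : ℂ)).HasTemperateGrowth := by fun_prop
  have hin : ∀ ξ : EuclideanSpace ℝ (Fin d), inner ℝ ξ (EuclideanSpace.single j (1 : ℝ)) = ξ j :=
    fun ξ => by simp [EuclideanSpace.inner_single_right]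
  have key : ∀ φ : SchwartzMap (EuclideanSpace ℝ (Fin d)) ℂ,
      ((2 * Real.pi * Complex.I) • TemperedDistribution.smulLeftCLM ℂ
        (fun ξ : EuclideanSpace ℝ (Fin d) =>
          ((inner ℝ ξ (EuclideanSpace.single j (1 : ℝ)) : ℝ) : ℂ))
        (Lp.toTemperedDistribution (𝓕 u : L2 d))) φ =
      ∫ ξ, φ ξ • ((2 * Real.pi * Complex.I * ξ j) * (𝓕 u : L2 d) ξ) := by
    intro φ
    change (2 * Real.pi * Complex.I) • (Lp.toTemperedDistribution (𝓕 u : L2 d))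
      (SchwartzMap.smulLeftCLM ℂ (fun ξ : EuclideanSpace ℝ (Fin d) =>
          ((inner ℝ ξ (EuclideanSpace.single j (1 : ℝ)) : ℝ) : ℂ)) φ) = _
    rw [Lp.toTemperedDistribution_apply, ← integral_smul]
    congr 1
    ext ξ
    rw [SchwartzMap.smulLeftCLM_apply_apply htg, hin]
    simp only [smul_eq_mul]
    ring
  constructor
  · intro h
    -- both sides are locally integrable, so it is enough to test against smooth functions
    refine ae_eq_of_integral_contDiff_smul_eq ((Lp.memLp _).locallyIntegrable (by norm_num)) ?_ ?_
    · have h1 : LocallyIntegrable (𝓕 u : L2 d) volume :=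
        (Lp.memLp _).locallyIntegrable (by norm_num)
      rw [← locallyIntegrableOn_univ] at h1 ⊢
      refine h1.continuousOn_mul (Continuous.continuousOn (by fun_prop)) isOpen_univ.isLocallyClosed
    · intro φ hφ hφc
      have hg₁ : HasCompactSupport (Complex.ofRealCLM ∘ φ) := hφc.comp_left rfl
      have hg₂ : ContDiff ℝ ((⊤ : ℕ∞) : WithTop ℕ∞) (Complex.ofRealCLM ∘ φ) := by fun_prop
      have h1 := DFunLike.congr_fun h (hg₁.toSchwartzMap hg₂)
      rw [key, Lp.toTemperedDistribution_apply] at h1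
      simpa using h1.symm
  · intro h
    ext φ
    rw [key, Lp.toTemperedDistribution_apply]
    refine integral_congr_ae ?_
    filter_upwards [h] with ξ hξ
    rw [hξ]

end NLSRelaxation

end

/-! ### Kinetic energy and energy from an arbitrary diagonalisation -/

section

open MeasureTheory ENNReal Filter Topology FourierTransform

namespace NLSRelaxation

variable {d : ℕ}

theorem sum_enorm_sq_eq_symbol (ξ : EuclideanSpace ℝ (Fin d)) :
    ∑ j, ‖2 * Real.pi * Complex.I * ξ j‖ₑ ^ 2 = symbol ξ := by
  have h (j : Fin d) : ‖2 * Real.pi * Complex.I * ξ j‖ₑ ^ 2 =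
      ENNReal.ofReal (4 * Real.pi ^ 2 * ‖ξ j‖ ^ 2) := by
    rw [← ofReal_norm, ← ENNReal.ofReal_pow (norm_nonneg _)]
    congr 1
    simp only [Complex.norm_mul, Complex.norm_I, Complex.norm_real, Complex.norm_ofNat,
      Real.norm_of_nonneg Real.pi_pos.le]
    ring
  simp_rw [h]
  rw [← ENNReal.ofReal_sum_of_nonneg fun j _ => by positivity, ← Finset.mul_sum,
    ← EuclideanSpace.norm_sq_eq, symbol]

theorem enorm_fourier (u : L2 d) : ‖(𝓕 u : L2 d)‖ₑ = ‖u‖ₑ := by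
  rw [← ofReal_norm, Lp.norm_fourier_eq, ofReal_norm]

theorem IsWeakGradient.sum_enorm_sq {u : L2 d} {g : Fin d → L2 d} (h : IsWeakGradient u g) :
    ∑ j, ‖g j‖ₑ ^ 2 = ∫⁻ ξ, symbol ξ * ‖(𝓕 u : L2 d) ξ‖ₑ ^ 2 := by
  have h1 (j : Fin d) : ‖g j‖ₑ ^ 2 =
      ∫⁻ ξ, ‖2 * Real.pi * Complex.I * ξ j‖ₑ ^ 2 * ‖(𝓕 u : L2 d) ξ‖ₑ ^ 2 := by
    rw [← enorm_fourier, enorm_sq_eq_lintegral]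
    refine lintegral_congr_ae ?_
    filter_upwards [(lineDerivOp_eq_iff u (g j) j).1 (h j)] with ξ hξ
    rw [hξ, enorm_mul, mul_pow]
  simp_rw [h1]
  rw [← lintegral_finsetSum]
  · simp_rw [← Finset.sum_mul, sum_enorm_sq_eq_symbol]
  · intro j _
    have : Measurable (fun ξ => (𝓕 u : L2 d) ξ) := (Lp.stronglyMeasurable _).measurable
    fun_prop

theorem exists_isWeakGradient {u : L2 d}
    (h : ∫⁻ ξ, symbol ξ * ‖(𝓕 u : L2 d) ξ‖ₑ ^ 2 < ⊤) : ∃ g, IsWeakGradient u g := by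
  have hm (j : Fin d) :
      MemLp (fun ξ => (2 * Real.pi * Complex.I * ξ j) * (𝓕 u : L2 d) ξ) 2 volume := by
    have hmeas : Measurable (fun ξ => (𝓕 u : L2 d) ξ) := (Lp.stronglyMeasurable _).measurable
    refine ⟨Measurable.aestronglyMeasurable (by fun_prop), ?_⟩
    rw [eLpNorm_lt_top_iff_lintegral_rpow_enorm_lt_top (by norm_num) (by norm_num)]
    refine lt_of_le_of_lt (lintegral_mono fun ξ => ?_) h
    rw [← sum_enorm_sq_eq_symbol, ENNReal.toReal_ofNat, ENNReal.rpow_ofNat, enorm_mul, mul_pow]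
    gcongr
    exact Finset.single_le_sum (f := fun j => ‖2 * Real.pi * Complex.I * ξ j‖ₑ ^ 2)
      (fun _ _ => zero_le) (Finset.mem_univ j)
  refine ⟨fun j => 𝓕⁻ ((hm j).toLp), fun j => (lineDerivOp_eq_iff _ _ _).2 ?_⟩
  rw [FourierTransform.fourier_fourierInv_eq]
  exact (hm j).coeFn_toLp

/-- The Dirichlet integral in Fourier space. -/
theorem dirichlet_eq (u : L2 d) : dirichlet u = ∫⁻ ξ, symbol ξ * ‖(𝓕 u : L2 d) ξ‖ₑ ^ 2 := by
  unfold dirichlet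
  refine le_antisymm ?_ (le_iInf₂ fun g hg => hg.sum_enorm_sq.ge)
  rcases eq_top_or_lt_top (∫⁻ ξ, symbol ξ * ‖(𝓕 u : L2 d) ξ‖ₑ ^ 2) with h | h
  · rw [h]; exact le_top
  · obtain ⟨g, hg⟩ := exists_isWeakGradient h
    exact (iInf₂_le g hg).trans hg.sum_enorm_sq.le

theorem IsWeakGradient.dirichlet_eq {u : L2 d} {g : Fin d → L2 d} (h : IsWeakGradient u g) :
    dirichlet u = ∑ j, ‖g j‖ₑ ^ 2 := by
  rw [NLSRelaxation.dirichlet_eq, h.sum_enorm_sq]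

theorem memH1_iff (u : L2 d) : MemH1 u ↔ dirichlet u < ⊤ := by
  constructor
  · rintro ⟨g, hg⟩
    rw [hg.dirichlet_eq]
    exact ENNReal.sum_lt_top.2 fun j _ => ENNReal.pow_lt_top enorm_lt_top
  · intro h
    rw [dirichlet_eq] at h
    exact exists_isWeakGradient h

theorem tsum_mul_dirichlet (n : ℕ → ENNReal) (u : ℕ → L2 d) :
    ∑' i, n i * dirichlet (u i) =
      ∫⁻ ξ, symbol ξ * ∑' i, n i * ‖(𝓕 (u i) : L2 d) ξ‖ₑ ^ 2 := by
  have hm (i : ℕ) : Measurable (fun ξ => ‖(𝓕 (u i) : L2 d) ξ‖ₑ ^ 2) :=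
    (Lp.stronglyMeasurable _).enorm.pow_const 2
  have hm' (i : ℕ) : Measurable (fun ξ => symbol ξ * ‖(𝓕 (u i) : L2 d) ξ‖ₑ ^ 2) :=
    measurable_symbol.mul (hm i)
  simp_rw [dirichlet_eq, ← ENNReal.tsum_mul_left]
  rw [lintegral_tsum]
  · congr 1
    ext i
    rw [← lintegral_const_mul _ (hm' i)]
    congr 1
    ext ξ
    ring
  · exact fun i => (measurable_symbol.mul ((hm i).const_mul _)).aemeasurable

/-- The kinetic energy of `γ` may be computed from any diagonalisation: it is the integral of the
symbol against the density of `γ` in Fourier space. -/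
theorem IsDiagonalisation.kineticEnergy_eq {γ : L2 d →L[ℂ] L2 d} {n : ℕ → ℝ} {u : ℕ → L2 d}
    (h : IsDiagonalisation γ n u) :
    kineticEnergy γ = ∑' i, ENNReal.ofReal (n i) * dirichlet (u i) := by
  unfold kineticEnergy
  rw [tsum_mul_dirichlet, tsum_mul_dirichlet]
  refine lintegral_congr_ae ?_
  filter_upwards [(isDiagonalisation_diagonalisation ⟨n, u, h⟩).density_ae_eq h
    (Lp.fourierTransformₗᵢ (EuclideanSpace ℝ (Fin d)) ℂ)] with ξ hξ
  exact congrArg _ hξ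

/-- The energy of `γ` may be computed from any diagonalisation. -/
theorem IsDiagonalisation.energy_eq (p : ℝ) {γ : L2 d →L[ℂ] L2 d} {n : ℕ → ℝ} {u : ℕ → L2 d}
    (h : IsDiagonalisation γ n u) :
    energy p γ = energyOf p (∑' i, ENNReal.ofReal (n i) * dirichlet (u i))
      (fun x => ∑' i, ENNReal.ofReal (n i) * ‖u i x‖ₑ ^ 2) := by
  unfold energy energyOf
  rw [h.kineticEnergy_eq]
  congr 3
  refine lintegral_congr_ae ?_
  filter_upwards [(isDiagonalisation_diagonalisation ⟨n, u, h⟩).density_ae_eq h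
    (LinearIsometryEquiv.refl ℂ _)] with x hx
  exact congrArg (· ^ p) hx

section FiniteRank

variable {ι : Type*} [Fintype ι] {w : ι → ℝ} {u : ι → L2 d}

theorem energy_sum_rankOne (hd : 1 ≤ d) (p : ℝ) (hw : ∀ i, 0 ≤ w i) (hu : Orthonormal ℂ u) :
    energy p (∑ i, (w i : ℂ) • InnerProductSpace.rankOne ℂ (u i) (u i)) =
      energyOf p (∑ i, ENNReal.ofReal (w i) * dirichlet (u i))
        (fun x => ∑ i, ENNReal.ofReal (w i) * ‖u i x‖ₑ ^ 2) := by
  obtain ⟨v, φ, hv, hφ, hvu⟩ := exists_orthonormal_extension hd hu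
  rw [(isDiagonalisation_sum hw hv hφ hvu).energy_eq]
  congr 1
  · rw [tsum_extend_mul hφ]; simp_rw [hvu]
  · ext x
    rw [tsum_extend_mul hφ w (fun k => ‖v k x‖ₑ ^ 2)]; simp_rw [hvu]

theorem admissible_sum_rankOne (hd : 1 ≤ d) (hw : ∀ i, 0 ≤ w i) (hw' : ∀ i, w i ≤ 1)
    (hu : Orthonormal ℂ u) (hu' : ∀ i, MemH1 (u i)) :
    Admissible (∑ i, w i) (∑ i, (w i : ℂ) • InnerProductSpace.rankOne ℂ (u i) (u i)) := by
  obtain ⟨v, φ, hv, hφ, hvu⟩ := exists_orthonormal_extension hd hu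
  have h := isDiagonalisation_sum hw hv hφ hvu
  refine ⟨h.isPositive, h.le_one fun k => ?_, ?_, ?_⟩
  · by_cases hk : ∃ i, φ i = k
    · obtain ⟨i, rfl⟩ := hk
      rw [hφ.extend_apply]; exact hw' i
    · rw [Function.extend_apply' _ _ _ hk]; exact zero_le_one
  · have := tsum_extend_mul hφ w (fun _ => 1)
    simp only [mul_one] at this
    rw [h.trace_eq, this, ENNReal.ofReal_sum_of_nonneg fun i _ => hw i]
  · rw [h.kineticEnergy_eq, tsum_extend_mul hφ]
    refine ENNReal.sum_lt_top.2 fun i _ => ENNReal.mul_lt_top ENNReal.ofReal_lt_top ?_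
    rw [hvu]
    exact (memH1_iff _).1 (hu' i)

end FiniteRank

/-- Every admissible operator is described by occupation numbers in `[0, 1]`. -/
theorem Admissible.exists_isDiagonalisation (hd : 1 ≤ d) {lam : ℝ} {γ : L2 d →L[ℂ] L2 d}
    (h : Admissible lam γ) :
    ∃ n u, IsDiagonalisation γ n u ∧ (∀ i, n i ≤ 1) ∧
      ∑' i, ENNReal.ofReal (n i) = ENNReal.ofReal lam ∧
      ∑' i, ENNReal.ofReal (n i) * dirichlet (u i) < ⊤ := by
  obtain ⟨n, u, hnu⟩ := NLSRelaxation.exists_isDiagonalisation hd h.isPositive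
    (by rw [h.trace_eq]; exact ENNReal.ofReal_ne_top)
  refine ⟨n, u, hnu, hnu.le_one_of_le_one h.le_one, ?_, ?_⟩
  · rw [← hnu.trace_eq, h.trace_eq]
  · rw [← hnu.kineticEnergy_eq]; exact h.kinetic_lt_top

end NLSRelaxation

end

/-! ### Concavity of the energy and extremal occupation numbers -/

section

open MeasureTheory ENNReal Filter Topology

namespace NLSRelaxation

variable {d : ℕ}

theorem energyOf_mono {p : ℝ} (hp : 0 ≤ p) {K K' : ENNReal}
    {ρ ρ' : EuclideanSpace ℝ (Fin d) → ENNReal} (hK : K ≤ K') (hρ : ∀ x, ρ' x ≤ ρ x) :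
    energyOf p K ρ ≤ energyOf p K' ρ' := by
  unfold energyOf
  refine EReal.sub_le_sub (EReal.coe_ennreal_le_coe_ennreal_iff.2 hK)
    (EReal.coe_ennreal_le_coe_ennreal_iff.2 ?_)
  gcongr with x
  exact hρ x

/-- If `K` is the average of `K₁` and `K₂`, and `P` is at most the average of `P₁` and `P₂`, then
one of the differences `Kᵢ - Pᵢ` is at most `K - P`. The values `Pᵢ = ∞` are allowed. -/
theorem sub_le_sub_or_of_concave {a b K K₁ K₂ P P₁ P₂ : ENNReal} (hab : a + b = 1) (ha : a ≠ 0)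
    (hb : b ≠ 0) (hK : K = a * K₁ + b * K₂) (hKt : K ≠ ⊤) (hP : P ≤ a * P₁ + b * P₂) :
    (K₁ : EReal) - P₁ ≤ K - P ∨ (K₂ : EReal) - P₂ ≤ K - P := by
  have hK₁ : K₁ ≠ ⊤ := by
    rintro rfl; simp [hK, ENNReal.mul_top ha] at hKt
  have hK₂ : K₂ ≠ ⊤ := by
    rintro rfl; simp [hK, ENNReal.mul_top hb] at hKt
  rcases eq_or_ne P₁ ⊤ with rfl | hP₁
  · left; simp
  rcases eq_or_ne P₂ ⊤ with rfl | hP₂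
  · right; simp
  have hat : a ≠ ⊤ := by rintro rfl; simp at hab
  have hbt : b ≠ ⊤ := by rintro rfl; simp at hab
  have hPt : P ≠ ⊤ := ne_top_of_le_ne_top (by finiteness) hP
  lift a to NNReal using hat
  lift b to NNReal using hbt
  lift K to NNReal using hKt
  lift K₁ to NNReal using hK₁
  lift K₂ to NNReal using hK₂
  lift P to NNReal using hPt
  lift P₁ to NNReal using hP₁
  lift P₂ to NNReal using hP₂
  norm_cast at hab hK hP ha hb
  have ha' : (0 : ℝ) < a := by exact_mod_cast pos_iff_ne_zero.2 ha
  have hb' : (0 : ℝ) < b := by exact_mod_cast pos_iff_ne_zero.2 hb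
  have hab' : (a : ℝ) + b = 1 := by exact_mod_cast hab
  have hK' : (K : ℝ) = a * K₁ + b * K₂ := by exact_mod_cast hK
  have hP' : (P : ℝ) ≤ a * P₁ + b * P₂ := by exact_mod_cast hP
  simp only [EReal.coe_nnreal_eq_coe_real, ← EReal.coe_sub, EReal.coe_le_coe_iff]
  by_contra hcon
  rw [not_or, not_le, not_le] at hcon
  have h1 := mul_lt_mul_of_pos_left hcon.1 ha'
  have h2 := mul_lt_mul_of_pos_left hcon.2 hb'
  have h3 : (a : ℝ) * (K - P) + b * (K - P) = K - P := by rw [← add_mul, hab', one_mul]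
  nlinarith

/-- The energy is a concave function of the pair `(K, ρ)`; hence on a segment one of the end points
has an energy which is not larger. -/
theorem energyOf_le_or_le {p : ℝ} (hp : 1 ≤ p) {a b K K₁ K₂ : ENNReal}
    {ρ ρ₁ ρ₂ : EuclideanSpace ℝ (Fin d) → ENNReal} (hρ₁ : Measurable ρ₁)
    (hab : a + b = 1) (ha : a ≠ 0)
    (hb : b ≠ 0) (hK : K = a * K₁ + b * K₂) (hKt : K ≠ ⊤) (hρ : ∀ x, ρ x = a * ρ₁ x + b * ρ₂ x) :
    energyOf p K₁ ρ₁ ≤ energyOf p K ρ ∨ energyOf p K₂ ρ₂ ≤ energyOf p K ρ := by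
  refine sub_le_sub_or_of_concave hab ha hb hK hKt ?_
  have hat : a ≠ ⊤ := by rintro rfl; simp at hab
  have hbt : b ≠ ⊤ := by rintro rfl; simp at hab
  calc ENNReal.ofReal (1 / p) * ∫⁻ x, ρ x ^ p
      ≤ ENNReal.ofReal (1 / p) * ∫⁻ x, (a * ρ₁ x ^ p + b * ρ₂ x ^ p) := by
        gcongr with x
        rw [hρ]
        exact ENNReal.rpow_arith_mean_le_arith_mean2_rpow a b _ _ hab hp
    _ = _ := by
        rw [lintegral_add_left ((hρ₁.pow_const p).const_mul _), lintegral_const_mul' _ _ hat,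
          lintegral_const_mul' _ _ hbt]
        ring

section Extremal

variable {ι : Type*} (p : ℝ) (s : Finset ι) (D : ι → ENNReal)
  (R : ι → EuclideanSpace ℝ (Fin d) → ENNReal)

/-- The energy of a state with occupation numbers `n`, where the `i`-th orbital has kinetic energy
`D i` and density `R i`. -/
def occupationEnergy (n : ι → ℝ) : EReal :=
  energyOf p (∑ i ∈ s, ENNReal.ofReal (n i) * D i) (fun x => ∑ i ∈ s, ENNReal.ofReal (n i) * R i x)

/-- The orbitals which are neither empty nor full. -/
def fractionalSet (n : ι → ℝ) : Finset ι := {i ∈ s | 0 < n i ∧ n i < 1}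

variable {p s D R}

theorem ofReal_sum_convex {α β : ℝ} (hα : 0 ≤ α) (hβ : 0 ≤ β) {n m₁ m₂ : ι → ℝ}
    (hm₁ : ∀ i ∈ s, 0 ≤ m₁ i) (hm₂ : ∀ i ∈ s, 0 ≤ m₂ i)
    (h : ∀ i ∈ s, n i = α * m₁ i + β * m₂ i) (F : ι → ENNReal) :
    ∑ i ∈ s, ENNReal.ofReal (n i) * F i =
      ENNReal.ofReal α * ∑ i ∈ s, ENNReal.ofReal (m₁ i) * F i +
      ENNReal.ofReal β * ∑ i ∈ s, ENNReal.ofReal (m₂ i) * F i := by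
  rw [Finset.mul_sum, Finset.mul_sum, ← Finset.sum_add_distrib]
  refine Finset.sum_congr rfl fun i hi => ?_
  rw [h i hi, ENNReal.ofReal_add (mul_nonneg hα (hm₁ i hi)) (mul_nonneg hβ (hm₂ i hi)),
    ENNReal.ofReal_mul hα, ENNReal.ofReal_mul hβ]
  ring

/-- Moving the charge `t` from the orbital `j` to the orbital `i`, both fractionally occupied, until
one of them becomes empty or full. -/
theorem transfer_spec [DecidableEq ι] {n : ι → ℝ} (hn : ∀ i ∈ s, n i ∈ Set.Icc (0 : ℝ) 1) {i j : ι}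
    (hij : i ≠ j) (hi : i ∈ fractionalSet s n) (hj : j ∈ fractionalSet s n) {t : ℝ} {m : ι → ℝ}
    (hm : m = n + t • (Pi.single i 1 - Pi.single j 1))
    (h1 : 0 ≤ n i + t) (h2 : n i + t ≤ 1) (h3 : 0 ≤ n j - t) (h4 : n j - t ≤ 1)
    (h5 : n i + t = 0 ∨ n i + t = 1 ∨ n j - t = 0 ∨ n j - t = 1) :
    (∀ i ∈ s, m i ∈ Set.Icc (0 : ℝ) 1) ∧ ∑ i ∈ s, m i = ∑ i ∈ s, n i ∧
      (fractionalSet s m).card < (fractionalSet s n).card := by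
  have hmi : m i = n i + t := by simp [hm, hij]
  have hmj : m j = n j - t := by simp [hm, hij.symm]; ring
  have hmk : ∀ k, k ≠ i → k ≠ j → m k = n k := fun k hki hkj => by simp [hm, hki, hkj]
  have his : i ∈ s := (Finset.mem_filter.1 hi).1
  have hjs : j ∈ s := (Finset.mem_filter.1 hj).1
  refine ⟨fun k hk => ?_, ?_, Finset.card_lt_card (Finset.ssubset_iff_subset_ne.2 ⟨?_, ?_⟩)⟩
  · by_cases hki : k = i
    · subst hki; rw [hmi]; exact ⟨h1, h2⟩
    by_cases hkj : k = j
    · subst hkj; rw [hmj]; exact ⟨h3, h4⟩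
    rw [hmk k hki hkj]; exact hn k hk
  · simp only [hm, Pi.add_apply, Pi.smul_apply, Pi.sub_apply, smul_eq_mul, Finset.sum_add_distrib,
      ← Finset.mul_sum, Finset.sum_sub_distrib]
    simp [his, hjs]
  · intro k hk
    by_cases hki : k = i
    · rwa [hki]
    by_cases hkj : k = j
    · rwa [hkj]
    rw [fractionalSet, Finset.mem_filter, hmk k hki hkj] at hk
    exact Finset.mem_filter.2 hk
  · intro heq
    rw [← heq, fractionalSet, Finset.mem_filter, hmi] at hi
    rw [← heq, fractionalSet, Finset.mem_filter, hmj] at hj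
    obtain ⟨-, hi1, hi2⟩ := hi
    obtain ⟨-, hj1, hj2⟩ := hj
    rcases h5 with h | h | h | h <;> linarith

/-- If two orbitals are fractionally occupied, then moving charge from one to the other in one of
the two directions, until one of them becomes empty or full, does not increase the energy. -/
theorem exists_fewer_fractional [DecidableEq ι] (hp : 1 ≤ p) (hD : ∀ i ∈ s, D i ≠ ⊤)
    (hR : ∀ i, Measurable (R i)) {n : ι → ℝ}
    (hn : ∀ i ∈ s, n i ∈ Set.Icc (0 : ℝ) 1) {i j : ι}
    (hij : i ≠ j) (hi : i ∈ fractionalSet s n) (hj : j ∈ fractionalSet s n) :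
    ∃ m : ι → ℝ, (∀ i ∈ s, m i ∈ Set.Icc (0 : ℝ) 1) ∧ ∑ i ∈ s, m i = ∑ i ∈ s, n i ∧
      (fractionalSet s m).card < (fractionalSet s n).card ∧
      occupationEnergy p s D R m ≤ occupationEnergy p s D R n := by
  obtain ⟨-, hi1, hi2⟩ := Finset.mem_filter.1 hi
  obtain ⟨-, hj1, hj2⟩ := Finset.mem_filter.1 hj
  -- the largest charges that can be moved from `i` to `j` and from `j` to `i`
  set a := min (n i) (1 - n j) with ha
  set b := min (1 - n i) (n j) with hb
  have ha0 : 0 < a := lt_min hi1 (by linarith)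
  have hb0 : 0 < b := lt_min (by linarith) hj1
  have ha1 : a ≤ n i := min_le_left _ _
  have ha2 : a ≤ 1 - n j := min_le_right _ _
  have hb1 : b ≤ 1 - n i := min_le_left _ _
  have hb2 : b ≤ n j := min_le_right _ _
  obtain ⟨hm₁, hs₁, hc₁⟩ := transfer_spec hn hij hi hj (t := -a) rfl (by linarith) (by linarith)
    (by linarith) (by linarith) (by
      rcases min_choice (n i) (1 - n j) with h | h
      · left; rw [ha, h]; ring
      · right; right; right; rw [ha, h]; ring)
  obtain ⟨hm₂, hs₂, hc₂⟩ := transfer_spec hn hij hi hj (t := b) rfl (by linarith) (by linarith)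
    (by linarith) (by linarith) (by
      rcases min_choice (1 - n i) (n j) with h | h
      · right; left; rw [hb, h]; ring
      · right; right; left; rw [hb, h]; ring)
  set m₁ := n + (-a) • (Pi.single i 1 - Pi.single j 1 : ι → ℝ) with hm₁def
  set m₂ := n + b • (Pi.single i 1 - Pi.single j 1 : ι → ℝ) with hm₂def
  have hab : 0 < a + b := by linarith
  have hconv : ∀ k ∈ s, n k = (b / (a + b)) * m₁ k + (a / (a + b)) * m₂ k := by
    intro k _
    simp only [hm₁def, hm₂def, Pi.add_apply, Pi.smul_apply, smul_eq_mul]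
    field_simp
    ring
  have hsum := ofReal_sum_convex (by positivity) (by positivity) (fun k hk => (hm₁ k hk).1)
    (fun k hk => (hm₂ k hk).1) hconv
  have hone : ENNReal.ofReal (b / (a + b)) + ENNReal.ofReal (a / (a + b)) = 1 := by
    rw [← ENNReal.ofReal_add (by positivity) (by positivity), ← ENNReal.ofReal_one]
    congr 1
    field_simp
    ring
  have key := energyOf_le_or_le hp
    (ρ₁ := fun x => ∑ i ∈ s, ENNReal.ofReal (m₁ i) * R i x)
    (Finset.measurable_sum _ fun i _ => (hR i).const_mul _) hone
    (ENNReal.ofReal_pos.2 (by positivity)).ne' (ENNReal.ofReal_pos.2 (by positivity)).ne'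
    (hsum D) (ENNReal.sum_ne_top.2 fun i hi => ENNReal.mul_ne_top ENNReal.ofReal_ne_top (hD i hi))
    (fun x => hsum fun i => R i x)
  rcases key with h | h
  · exact ⟨m₁, hm₁, hs₁, hc₁, h⟩
  · exact ⟨m₂, hm₂, hs₂, hc₂, h⟩

/-- Among the states with the same total charge, there is one with at most one fractionally
occupied orbital whose energy is not larger. -/
theorem exists_extremal [DecidableEq ι] (hp : 1 ≤ p) (hD : ∀ i ∈ s, D i ≠ ⊤)
    (hR : ∀ i, Measurable (R i)) (n : ι → ℝ) (hn : ∀ i ∈ s, n i ∈ Set.Icc (0 : ℝ) 1) :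
    ∃ m : ι → ℝ, (∀ i ∈ s, m i ∈ Set.Icc (0 : ℝ) 1) ∧ ∑ i ∈ s, m i = ∑ i ∈ s, n i ∧
      (fractionalSet s m).card ≤ 1 ∧
      occupationEnergy p s D R m ≤ occupationEnergy p s D R n := by
  induction hk : (fractionalSet s n).card using Nat.strong_induction_on generalizing n with
  | _ k ih =>
    by_cases hc : (fractionalSet s n).card ≤ 1
    · exact ⟨n, hn, rfl, hc, le_rfl⟩
    · obtain ⟨i, hi, j, hj, hij⟩ := Finset.one_lt_card.1 (not_le.1 hc)
      obtain ⟨m, hm, hms, hmc, hmE⟩ := exists_fewer_fractional hp hD hR hn hij hi hj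
      obtain ⟨m', h1, h2, h3, h4⟩ := ih _ (hk ▸ hmc) m hm rfl
      exact ⟨m', h1, h2.trans hms, h3, h4.trans hmE⟩

end Extremal

end NLSRelaxation

end

/-! ### Reduction of the relaxed problem to finite rank -/

section

open MeasureTheory ENNReal Filter Topology

namespace NLSRelaxation

variable {d : ℕ}

theorem energy_finiteRankOperator (hd : 1 ≤ d) (p : ℝ) {N : ℕ} {lam : ℝ} (hlam : (N : ℝ) - 1 ≤ lam)
    {u : Fin N → L2 d} (hu : Orthonormal ℂ u) :
    energy p (finiteRankOperator lam u) =
      energyOf p (∑ i : Fin N, ENNReal.ofReal (if (i : ℕ) + 1 = N then lam - N + 1 else 1) *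
          dirichlet (u i))
        (fun x => ∑ i : Fin N, ENNReal.ofReal (if (i : ℕ) + 1 = N then lam - N + 1 else 1) *
          ‖u i x‖ₑ ^ 2) := by
  refine energy_sum_rankOne hd p (w := fun i : Fin N =>
    if (i : ℕ) + 1 = N then lam - N + 1 else 1) (fun i => ?_) hu
  split_ifs
  · linarith
  · exact zero_le_one

theorem admissible_finiteRankOperator (hd : 1 ≤ d) {N : ℕ} (hN : 1 ≤ N) {lam : ℝ}
    (h1 : (N : ℝ) - 1 ≤ lam) (h2 : lam ≤ N)
    {u : Fin N → L2 d} (hu : Orthonormal ℂ u) (hu' : ∀ i, MemH1 (u i)) :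
    Admissible lam (finiteRankOperator lam u) := by
  have hw : ∑ i : Fin N, (if (i : ℕ) + 1 = N then lam - N + 1 else 1) = lam := by
    obtain ⟨t, rfl⟩ : ∃ t, N = t + 1 := ⟨N - 1, by omega⟩
    rw [Fin.sum_univ_castSucc]
    have : ∀ i : Fin t, (((Fin.castSucc i : Fin (t + 1)) : ℕ) + 1 = t + 1) ↔ False := fun i => by
      have := i.2; simp; omega
    simp only [this, if_false, Fin.val_last, if_true]
    simp only [Finset.sum_const, Finset.card_univ, Fintype.card_fin, nsmul_eq_mul, mul_one]
    push_cast
    ring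
  have h : Admissible (∑ i : Fin N, (if (i : ℕ) + 1 = N then lam - N + 1 else 1))
      (finiteRankOperator lam u) := by
    refine admissible_sum_rankOne hd (w := fun i : Fin N =>
      if (i : ℕ) + 1 = N then lam - N + 1 else 1) (fun i => ?_) (fun i => ?_) hu hu'
    · split_ifs
      · linarith
      · exact zero_le_one
    · split_ifs
      · linarith
      · exact le_rfl
  rwa [hw] at h

/-- A state in which at most one orbital is fractionally occupied is one of the operators in the
definition of `finiteRankInf`. -/
theorem finiteRankInf_le_of_fractionalSet_card_le_one (hd : 1 ≤ d) (p : ℝ) {lam : ℝ}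
    (hlam : 0 < lam) {N : ℕ} (hN : IsLeast {n : ℕ | lam ≤ (n : ℝ)} N) {ι : Type*} [DecidableEq ι]
    {s : Finset ι} {u : ι → L2 d} (hu : Orthonormal ℂ u) (hu' : ∀ i ∈ s, MemH1 (u i)) {m : ι → ℝ}
    (hm : ∀ i ∈ s, m i ∈ Set.Icc (0 : ℝ) 1) (hsum : ∑ i ∈ s, m i = lam)
    (hc : (fractionalSet s m).card ≤ 1) :
    finiteRankInf d p N lam ≤
      occupationEnergy p s (fun i => dirichlet (u i)) (fun i x => ‖u i x‖ₑ ^ 2) m := by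
  -- `i₀` is the fractionally occupied orbital or, if there is none, any full orbital
  obtain ⟨i₀, hi₀, hpos, hothers⟩ : ∃ i₀ ∈ s, 0 < m i₀ ∧ ∀ i ∈ s, i ≠ i₀ → m i = 0 ∨ m i = 1 := by
    have hdich : ∀ i ∈ s, i ∉ fractionalSet s m → m i = 0 ∨ m i = 1 := by
      intro i hi hif
      rcases (hm i hi).1.eq_or_lt with h | h
      · exact Or.inl h.symm
      rcases (hm i hi).2.eq_or_lt with h' | h'
      · exact Or.inr h'
      exact absurd (Finset.mem_filter.2 ⟨hi, h, h'⟩) hif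
    rcases (fractionalSet s m).eq_empty_or_nonempty with he | ⟨i₀, hi₀⟩
    · obtain ⟨i₀, hi₀, hne⟩ := Finset.exists_ne_zero_of_sum_ne_zero (hsum.trans_ne hlam.ne')
      exact ⟨i₀, hi₀, lt_of_le_of_ne (hm i₀ hi₀).1 hne.symm,
        fun i hi _ => hdich i hi (by simp [he])⟩
    · obtain ⟨h1, h2, -⟩ := Finset.mem_filter.1 hi₀
      exact ⟨i₀, h1, h2, fun i hi hne => hdich i hi fun hif =>
        hne (Finset.card_le_one.1 hc i hif i₀ hi₀)⟩
  set T := {i ∈ s.erase i₀ | m i = 1} with hT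
  have hsplit : ∀ (F : ι → ENNReal), ∑ i ∈ s, ENNReal.ofReal (m i) * F i =
      ∑ i ∈ T, F i + ENNReal.ofReal (m i₀) * F i₀ := by
    intro F
    rw [← Finset.sum_erase_add _ _ hi₀, hT, Finset.sum_filter]
    congr 1
    refine Finset.sum_congr rfl fun i hi => ?_
    rcases hothers i (Finset.mem_of_mem_erase hi) (Finset.ne_of_mem_erase hi) with h | h <;>
      simp [h]
  have hcard : lam = T.card + m i₀ := by
    rw [← hsum, ← Finset.sum_erase_add _ _ hi₀, hT, Finset.card_filter]
    push_cast
    congr 1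
    refine Finset.sum_congr rfl fun i hi => ?_
    rcases hothers i (Finset.mem_of_mem_erase hi) (Finset.ne_of_mem_erase hi) with h | h <;>
      simp [h]
  obtain rfl : N = T.card + 1 := by
    refine le_antisymm (hN.2 ?_) ?_
    · change lam ≤ ((T.card + 1 : ℕ) : ℝ)
      push_cast
      linarith [(hm i₀ hi₀).2]
    · have h1 : lam ≤ N := hN.1
      have : (T.card : ℝ) < N := by linarith
      exact_mod_cast this
  -- the full orbitals are listed first, then the orbital `i₀`
  set f : Fin T.card → ι := fun k => (T.equivFin.symm k : ι) with hf
  have hfT : ∀ k, f k ∈ T := fun k => (T.equivFin.symm k).2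
  set e : Fin (T.card + 1) → ι := Fin.snoc (α := fun _ => ι) f i₀ with he
  have hfinj : f.Injective := Subtype.val_injective.comp T.equivFin.symm.injective
  have heinj : e.Injective := by
    rw [he, Fin.snoc_injective_iff]
    refine ⟨hfinj, ?_⟩
    rintro ⟨k, hk⟩
    exact Finset.ne_of_mem_erase (Finset.mem_filter.1 (hfT k)).1 hk
  have hes : ∀ k, e k ∈ s := by
    intro k
    refine Fin.lastCases ?_ (fun k => ?_) k
    · rw [he, Fin.snoc_last]; exact hi₀
    · rw [he, Fin.snoc_castSucc]
      exact Finset.mem_of_mem_erase (Finset.mem_filter.1 (hfT k)).1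
  have hsum' : ∀ (F : ι → ENNReal), ∑ i : Fin (T.card + 1), ENNReal.ofReal
      (if (i : ℕ) + 1 = T.card + 1 then lam - (T.card + 1 : ℕ) + 1 else 1) * F (e i) =
      ∑ i ∈ s, ENNReal.ofReal (m i) * F i := by
    intro F
    have hne : ∀ i : Fin T.card, ((i : ℕ) + 1 = T.card + 1) ↔ False := fun i => by
      have := i.2; simp; omega
    rw [Fin.sum_univ_castSucc, hsplit]
    congr 1
    · simp only [Fin.val_castSucc, hne, if_false, ENNReal.ofReal_one, one_mul, he,
        Fin.snoc_castSucc]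
      rw [← Finset.sum_coe_sort T]
      exact Fintype.sum_equiv T.equivFin.symm _ _ fun _ => rfl
    · simp only [Fin.val_last, if_true, he, Fin.snoc_last]
      congr 2
      push_cast
      linarith
  have hue : Orthonormal ℂ (fun k => u (e k)) := hu.comp e heinj
  refine (iInf₂_le (fun k => u (e k)) ⟨fun k => hu' _ (hes k), hue⟩).trans (le_of_eq ?_)
  rw [energy_finiteRankOperator hd p (by push_cast; linarith) hue]
  unfold occupationEnergy
  rw [hsum' fun i => dirichlet (u i)]
  congr 1
  ext x
  exact hsum' fun i => ‖u i x‖ₑ ^ 2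

/-- The energy of a state with finitely many occupied orbitals is not below `finiteRankInf`. -/
theorem finiteRankInf_le_occupationEnergy (hd : 1 ≤ d) {p : ℝ} (hp : 1 ≤ p) {lam : ℝ}
    (hlam : 0 < lam) {N : ℕ} (hN : IsLeast {n : ℕ | lam ≤ (n : ℝ)} N) {ι : Type*} [DecidableEq ι]
    {s : Finset ι} {u : ι → L2 d} (hu : Orthonormal ℂ u) (hu' : ∀ i ∈ s, MemH1 (u i)) {n : ι → ℝ}
    (hn : ∀ i ∈ s, n i ∈ Set.Icc (0 : ℝ) 1) (hsum : ∑ i ∈ s, n i = lam) :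
    finiteRankInf d p N lam ≤
      occupationEnergy p s (fun i => dirichlet (u i)) (fun i x => ‖u i x‖ₑ ^ 2) n := by
  obtain ⟨m, h1, h2, h3, h4⟩ := exists_extremal (p := p) (s := s) (D := fun i => dirichlet (u i))
    (R := fun i x => ‖u i x‖ₑ ^ 2) hp (fun i hi => ((memH1_iff _).1 (hu' i hi)).ne)
    (fun i => (Lp.stronglyMeasurable (u i)).enorm.pow_const 2) n hn
  exact (finiteRankInf_le_of_fractionalSet_card_le_one hd p hlam hN hu hu' h1 (h2.trans hsum)
    h3).trans h4

/-- Some orbital in the tail has a kinetic energy which is at most the average kinetic energy of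
the tail. -/
theorem exists_le_average {n : ℕ → ENNReal} {D : ℕ → ENNReal} (hn : ∑' i, n i ≠ 0)
    (hnt : ∑' i, n i ≠ ⊤) (hD : ∑' i, n i * D i ≠ ⊤) :
    ∃ i, n i ≠ 0 ∧ (∑' i, n i) * D i ≤ ∑' i, n i * D i := by
  by_contra! hcon
  obtain ⟨i, hi⟩ : ∃ i, n i ≠ 0 := by
    by_contra! h
    simp [h] at hn
  have hni : n i ≠ ⊤ := ENNReal.ne_top_of_tsum_ne_top hnt i
  refine lt_irrefl ((∑' i, n i) * ∑' i, n i * D i) ?_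
  calc (∑' i, n i) * ∑' i, n i * D i = ∑' i, n i * ∑' j, n j * D j := by
        rw [ENNReal.tsum_mul_right]
    _ < ∑' i, n i * ((∑' j, n j) * D i) := by
        refine ENNReal.tsum_lt_tsum (i := i) ?_ (fun k => ?_) ?_
        · rw [ENNReal.tsum_mul_right]
          exact ENNReal.mul_ne_top hnt hD
        · rcases eq_or_ne (n k) 0 with h | h
          · simp [h]
          · gcongr
            exact (hcon k h).le
        · exact ENNReal.mul_lt_mul_right hi hni (hcon i hi)
    _ = (∑' i, n i) * ∑' i, n i * D i := by
        rw [← ENNReal.tsum_mul_left]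
        congr 1
        ext i
        ring

/-- Moving the charge of a tail to one orbital of low kinetic energy gives a competitor with finitely
many occupied orbitals. By `hM` the charge moved is at most `1`, so that it fits in one orbital. -/
theorem finiteRankInf_le_of_tail (hd : 1 ≤ d) {p : ℝ} (hp : 1 ≤ p) {lam : ℝ}
    (hlam : 0 < lam) {N : ℕ} (hN : IsLeast {n : ℕ | lam ≤ (n : ℝ)} N)
    {u : ℕ → L2 d} (hu : Orthonormal ℂ u) {n : ℕ → ℝ} (hn : ∀ i, n i ∈ Set.Icc (0 : ℝ) 1)
    (hK : ∑' i, ENNReal.ofReal (n i) * dirichlet (u i) ≠ ⊤) (hsum : HasSum n lam) {M : ℕ}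
    (hM : lam - ∑ i ∈ Finset.range M, n i ≤ 1) :
    finiteRankInf d p N lam ≤ energyOf p (∑' i, ENNReal.ofReal (n i) * dirichlet (u i))
      (fun x => ∑ i ∈ Finset.range M, ENNReal.ofReal (n i) * ‖u i x‖ₑ ^ 2) := by
  have hH1 : ∀ i, n i ≠ 0 → MemH1 (u i) := by
    intro i hi
    rw [memH1_iff]
    have h1 := ENNReal.ne_top_of_tsum_ne_top hK i
    by_contra h
    rw [not_lt, top_le_iff] at h
    rw [h, ENNReal.mul_top (ENNReal.ofReal_pos.2 (lt_of_le_of_ne (hn i).1 hi.symm)).ne'] at h1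
    exact h1 rfl
  set S := {i ∈ Finset.range M | n i ≠ 0} with hS
  have hSF : ∀ F : ℕ → ENNReal, ∑ i ∈ S, ENNReal.ofReal (n i) * F i =
      ∑ i ∈ Finset.range M, ENNReal.ofReal (n i) * F i := by
    intro F
    refine Finset.sum_filter_of_ne fun i _ h h0 => h ?_
    simp [h0]
  have hSn : ∑ i ∈ S, n i = ∑ i ∈ Finset.range M, n i :=
    Finset.sum_filter_of_ne fun i _ h => h
  have hsplit := (hsum.summable.sum_add_tsum_nat_add M).trans hsum.tsum_eq
  set ε := ∑' i, n (i + M) with hε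
  have hε0 : 0 ≤ ε := tsum_nonneg fun i => (hn _).1
  have hε1 : ε ≤ 1 := by linarith
  have htail : ∑' i, ENNReal.ofReal (n (i + M)) = ENNReal.ofReal ε :=
    (ENNReal.ofReal_tsum_of_nonneg (fun i => (hn _).1) ((summable_nat_add_iff M).2
      hsum.summable)).symm
  have hKsplit := ENNReal.summable.sum_add_tsum_nat_add' (k := M)
    (f := fun i => ENNReal.ofReal (n i) * dirichlet (u i))
  -- if the tail is empty, there is nothing to move and no average to compare with
  rcases hε0.eq_or_lt with h0 | hpos
  · refine (finiteRankInf_le_occupationEnergy hd hp hlam hN (s := S) hu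
      (fun i hi => hH1 i (Finset.mem_filter.1 hi).2) (fun i _ => hn i) ?_).trans ?_
    · rw [hSn]; linarith
    · unfold occupationEnergy
      simp_rw [hSF]
      refine energyOf_mono (by linarith) ?_ fun x => le_rfl
      rw [← hKsplit]
      exact le_self_add
  · have htop : ∑' i, ENNReal.ofReal (n (i + M)) * dirichlet (u (i + M)) ≠ ⊤ := by
      refine ne_top_of_le_ne_top hK ?_
      rw [← hKsplit]
      exact le_add_self
    obtain ⟨k, hk0, hk⟩ := exists_le_average (n := fun i => ENNReal.ofReal (n (i + M)))
      (D := fun i => dirichlet (u (i + M)))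
      (by rw [htail]; exact (ENNReal.ofReal_pos.2 hpos).ne')
      (by rw [htail]; exact ENNReal.ofReal_ne_top) htop
    rw [htail] at hk
    have hkS : k + M ∉ S := by simp [hS]
    -- the tail orbital `k + M` now carries the whole charge `ε` of the tail
    set m : ℕ → ℝ := Function.update n (k + M) ε with hm
    have hmk : m (k + M) = ε := Function.update_self _ _ _
    have hmS : ∀ i ∈ S, m i = n i := fun i hi =>
      Function.update_of_ne (ne_of_mem_of_not_mem hi hkS) _ _
    have hmF : ∀ F : ℕ → ENNReal, ∑ i ∈ insert (k + M) S, ENNReal.ofReal (m i) * F i =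
        ENNReal.ofReal ε * F (k + M) + ∑ i ∈ Finset.range M, ENNReal.ofReal (n i) * F i := by
      intro F
      rw [Finset.sum_insert hkS, hmk, ← hSF]
      congr 1
      exact Finset.sum_congr rfl fun i hi => by rw [hmS i hi]
    refine (finiteRankInf_le_occupationEnergy hd hp hlam hN (s := insert (k + M) S) (n := m) hu
      (fun i hi => ?_) (fun i hi => ?_) ?_).trans ?_
    · rcases Finset.mem_insert.1 hi with rfl | hi
      · refine hH1 _ fun h => hk0 ?_
        simp [h]
      · exact hH1 i (Finset.mem_filter.1 hi).2
    · rcases Finset.mem_insert.1 hi with rfl | hi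
      · rw [hmk]; exact ⟨hε0, hε1⟩
      · rw [hmS i hi]; exact hn i
    · rw [Finset.sum_insert hkS, hmk, Finset.sum_congr rfl hmS, hSn]
      linarith
    · unfold occupationEnergy
      simp_rw [hmF]
      refine energyOf_mono (by linarith) ?_ fun x => le_add_self
      rw [← hKsplit, add_comm]
      gcongr

/-- The energy of a state with infinitely many occupied orbitals is not below `finiteRankInf`. -/
theorem finiteRankInf_le (hd : 1 ≤ d) {p : ℝ} (hp : 1 ≤ p) {lam : ℝ}
    (hlam : 0 < lam) {N : ℕ} (hN : IsLeast {n : ℕ | lam ≤ (n : ℝ)} N)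
    {u : ℕ → L2 d} (hu : Orthonormal ℂ u) {n : ℕ → ℝ} (hn : ∀ i, n i ∈ Set.Icc (0 : ℝ) 1)
    (hK : ∑' i, ENNReal.ofReal (n i) * dirichlet (u i) ≠ ⊤)
    (hsum : ∑' i, ENNReal.ofReal (n i) = ENNReal.ofReal lam) :
    finiteRankInf d p N lam ≤ energyOf p (∑' i, ENNReal.ofReal (n i) * dirichlet (u i))
      (fun x => ∑' i, ENNReal.ofReal (n i) * ‖u i x‖ₑ ^ 2) := by
  have hsummable : Summable n := by
    have := ENNReal.summable_toReal (hsum.trans_ne ENNReal.ofReal_ne_top)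
    simpa [ENNReal.toReal_ofReal (hn _).1] using this
  have hsum' : HasSum n lam := by
    rw [← ENNReal.ofReal_tsum_of_nonneg (fun i => (hn i).1) hsummable] at hsum
    rw [ENNReal.ofReal_eq_ofReal_iff (tsum_nonneg fun i => (hn i).1) hlam.le] at hsum
    exact hsum ▸ hsummable.hasSum
  have hev : ∀ᶠ M in atTop, lam - ∑ i ∈ Finset.range M, n i ≤ 1 := by
    have := hsum'.tendsto_sum_nat.eventually (lt_mem_nhds (show lam - 1 < lam by linarith))
    filter_upwards [this] with M hM
    linarith
  set K := ∑' i, ENNReal.ofReal (n i) * dirichlet (u i) with hKdef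
  have hmono : Tendsto (fun M => ENNReal.ofReal (1 / p) * ∫⁻ x, (∑ i ∈ Finset.range M,
      ENNReal.ofReal (n i) * ‖u i x‖ₑ ^ 2) ^ p) atTop
      (𝓝 (ENNReal.ofReal (1 / p) * ∫⁻ x, (∑' i, ENNReal.ofReal (n i) * ‖u i x‖ₑ ^ 2) ^ p)) := by
    refine ENNReal.Tendsto.const_mul ?_ (Or.inr ENNReal.ofReal_ne_top)
    refine lintegral_tendsto_of_tendsto_of_monotone (fun M => ?_) (ae_of_all _ fun x => ?_)
      (ae_of_all _ fun x => ?_)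
    · exact ((Finset.measurable_sum _ fun i _ =>
        ((Lp.stronglyMeasurable (u i)).enorm.pow_const 2).const_mul _).pow_const p).aemeasurable
    · intro a b hab
      dsimp only
      gcongr
    · exact (ENNReal.continuous_rpow_const.tendsto _).comp (ENNReal.tendsto_nat_tsum _)
  have hlim : Tendsto (fun M => energyOf p K (fun x => ∑ i ∈ Finset.range M,
      ENNReal.ofReal (n i) * ‖u i x‖ₑ ^ 2)) atTop
      (𝓝 (energyOf p K (fun x => ∑' i, ENNReal.ofReal (n i) * ‖u i x‖ₑ ^ 2))) := by
    unfold energyOf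
    simp_rw [sub_eq_add_neg]
    -- the kinetic energy is finite, so that addition in `EReal` is continuous here
    have hKtop : (K : EReal) ≠ ⊤ := by simpa using hK
    have hKbot : (K : EReal) ≠ ⊥ := EReal.coe_ennreal_ne_bot K
    refine (EReal.continuousAt_add (Or.inl hKtop) (Or.inl hKbot)).tendsto.comp
      (tendsto_const_nhds.prodMk_nhds ?_)
    exact (continuous_neg.tendsto _).comp
      ((continuous_coe_ennreal_ereal.tendsto _).comp hmono)
  exact ge_of_tendsto hlim (hev.mono fun M hM =>
    finiteRankInf_le_of_tail hd hp hlam hN hu hn hK hsum' hM)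

theorem J_eq_finiteRankInf (hd : 1 ≤ d) {p : ℝ} (hp : 1 ≤ p) {lam : ℝ}
    (hlam : 0 < lam) {N : ℕ} (hN : IsLeast {n : ℕ | lam ≤ (n : ℝ)} N) :
    J d p lam = finiteRankInf d p N lam := by
  have h1 : lam ≤ N := hN.1
  have hN1 : 1 ≤ N := by
    have : (0 : ℝ) < N := hlam.trans_le h1
    exact_mod_cast this
  have h2 : (N : ℝ) - 1 ≤ lam := by
    by_contra h
    have h3 : N - 1 ∈ {n : ℕ | lam ≤ (n : ℝ)} := by
      change lam ≤ ((N - 1 : ℕ) : ℝ)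
      push_cast [hN1]
      linarith
    have := hN.2 h3
    omega
  refine le_antisymm ?_ ?_
  · refine le_iInf₂ fun u hu => ?_
    exact iInf₂_le _ (admissible_finiteRankOperator hd hN1 h2 h1 hu.2 hu.1)
  · refine le_iInf₂ fun γ hγ => ?_
    obtain ⟨n, u, hnu, hn1, hn, hK⟩ := hγ.exists_isDiagonalisation hd
    rw [hnu.energy_eq]
    exact finiteRankInf_le hd hp hlam hN hnu.orthonormal (fun i => ⟨hnu.nonneg i, hn1 i⟩) hK.ne hn

theorem energyOf_zero {p : ℝ} (hp : 0 < p) : energyOf (d := d) p 0 (fun _ => 0) = 0 := by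
  simp [energyOf, ENNReal.zero_rpow_of_pos hp]

theorem J_zero (hd : 1 ≤ d) {p : ℝ} (hp : 0 < p) : J d p 0 = 0 := by
  refine le_antisymm ?_ (le_iInf₂ fun γ hγ => ?_)
  · have hu : Orthonormal ℂ (Fin.elim0 : Fin 0 → L2 d) := ⟨fun i => i.elim0, fun i => i.elim0⟩
    have h := admissible_sum_rankOne hd (w := (Fin.elim0 : Fin 0 → ℝ)) (fun i => i.elim0)
      (fun i => i.elim0) hu (fun i => i.elim0)
    have he := energy_sum_rankOne hd p (w := (Fin.elim0 : Fin 0 → ℝ)) (fun i => i.elim0) hu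
    simp only [Finset.univ_eq_empty, Finset.sum_empty] at h he
    refine (iInf₂_le _ h).trans ?_
    rw [he, energyOf_zero hp]
  · obtain ⟨n, u, hnu, -, hn, -⟩ := hγ.exists_isDiagonalisation hd
    rw [ENNReal.ofReal_zero, ENNReal.tsum_eq_zero] at hn
    rw [hnu.energy_eq]
    simp [hn, energyOf_zero hp]

theorem J_natCast (hd : 1 ≤ d) {p : ℝ} (hp : 1 ≤ p) (N : ℕ) :
    J d p N = orthonormalInf d p N := by
  rcases Nat.eq_zero_or_pos N with rfl | hN
  · rw [Nat.cast_zero, J_zero hd (by linarith)]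
    refine le_antisymm (le_iInf₂ fun u _ => ?_) ?_
    · simp [systemEnergy, energyOf_zero (show 0 < p by linarith)]
    · refine (iInf₂_le Fin.elim0 ⟨fun i => i.elim0, fun i => i.elim0, fun i => i.elim0⟩).trans ?_
      simp [systemEnergy, energyOf_zero (show 0 < p by linarith)]
  · rw [J_eq_finiteRankInf hd hp (Nat.cast_pos.2 hN)
      (N := N) ⟨le_refl (N : ℝ), fun n hn => Nat.cast_le.1 (show (N : ℝ) ≤ n from hn)⟩]
    unfold finiteRankInf orthonormalInf
    refine iInf_congr fun u => iInf_congr fun hu => ?_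
    rw [energy_finiteRankOperator hd p (by linarith) hu.2]
    simp [systemEnergy]

end NLSRelaxation

end

/-! ### The case of at most one particle -/

section

open MeasureTheory ENNReal Filter Topology FourierTransform

namespace NLSRelaxation

variable {d : ℕ}

theorem dirichlet_smul (c : ℂ) (u : L2 d) : dirichlet (c • u) = ‖c‖ₑ ^ 2 * dirichlet u := by
  have hm : Measurable (fun ξ => symbol ξ * ‖(𝓕 u : L2 d) ξ‖ₑ ^ 2) :=
    measurable_symbol.mul ((Lp.stronglyMeasurable _).enorm.pow_const 2)
  rw [dirichlet_eq, dirichlet_eq, ← lintegral_const_mul _ hm, FourierTransform.fourier_smul]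
  refine lintegral_congr_ae ?_
  filter_upwards [Lp.coeFn_smul c (𝓕 u : L2 d)] with ξ hξ
  rw [hξ, Pi.smul_apply, enorm_smul]
  ring

theorem energyOf_congr {p : ℝ} {K : ENNReal} {ρ ρ' : EuclideanSpace ℝ (Fin d) → ENNReal}
    (h : ρ =ᵐ[volume] ρ') : energyOf p K ρ = energyOf p K ρ' := by
  unfold energyOf
  congr 3
  refine lintegral_congr_ae ?_
  filter_upwards [h] with x hx
  rw [hx]

theorem nlsEnergy_smul (p : ℝ) (c : ℂ) (u : L2 d) :
    nlsEnergy p (c • u) =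
      energyOf p (‖c‖ₑ ^ 2 * dirichlet u) (fun x => ‖c‖ₑ ^ 2 * ‖u x‖ₑ ^ 2) := by
  rw [nlsEnergy, dirichlet_smul]
  refine energyOf_congr ?_
  filter_upwards [Lp.coeFn_smul c u] with x hx
  rw [hx, Pi.smul_apply, enorm_smul, mul_pow]

theorem MemH1.smul {u : L2 d} (hu : MemH1 u) (c : ℂ) : MemH1 (c • u) := by
  rw [memH1_iff] at hu ⊢
  rw [dirichlet_smul]
  exact ENNReal.mul_lt_top (ENNReal.pow_lt_top enorm_lt_top) hu

/-- For `0 < λ ≤ 1` the competitors in `finiteRankInf` are `γ = |v⟩⟨v|` with `v = √λ u`. -/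
theorem finiteRankInf_one_eq_I (hd : 1 ≤ d) (p : ℝ) {lam : ℝ} (hlam : 0 < lam) :
    finiteRankInf d p 1 lam = I d p lam := by
  have henergy : ∀ u : Fin 1 → L2 d, Orthonormal ℂ u →
      energy p (finiteRankOperator lam u) = nlsEnergy p (((√lam : ℝ) : ℂ) • u 0) := by
    intro u hu
    have hs : ‖((√lam : ℝ) : ℂ)‖ₑ ^ 2 = ENNReal.ofReal lam := by
      rw [← ofReal_norm, ← ENNReal.ofReal_pow (norm_nonneg _), Complex.norm_real,
        Real.norm_of_nonneg (Real.sqrt_nonneg _), Real.sq_sqrt hlam.le]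
    rw [energy_finiteRankOperator hd p (by simpa using hlam.le) hu, nlsEnergy_smul, hs]
    simp
  refine le_antisymm (le_iInf₂ fun v hv => ?_) (le_iInf₂ fun u hu => ?_)
  · set u : Fin 1 → L2 d := fun _ => (((√lam)⁻¹ : ℝ) : ℂ) • v with hu
    have hsq : 0 < √lam := Real.sqrt_pos.2 hlam
    have hnorm : ‖v‖ = √lam := by rw [← hv.2, Real.sqrt_sq (norm_nonneg _)]
    have horth : Orthonormal ℂ u := by
      refine ⟨fun i => ?_, fun i j hij => absurd (Subsingleton.elim i j) hij⟩
      rw [hu, norm_smul, Complex.norm_real, Real.norm_of_nonneg (by positivity), hnorm]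
      field_simp
    refine (iInf₂_le u ⟨fun _ => hv.1.smul _, horth⟩).trans (le_of_eq ?_)
    rw [henergy u horth, hu, smul_smul, ← Complex.ofReal_mul, mul_inv_cancel₀ hsq.ne',
      Complex.ofReal_one, one_smul]
  · rw [henergy u hu.2]
    refine iInf₂_le _ ⟨(hu.1 0).smul _, ?_⟩
    rw [norm_smul, hu.2.1 0, Complex.norm_real, Real.norm_of_nonneg (Real.sqrt_nonneg _), mul_one,
      Real.sq_sqrt hlam.le]

theorem I_zero {p : ℝ} (hp : 0 < p) : I d p 0 = 0 := by
  have h0 : nlsEnergy (d := d) p 0 = 0 := by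
    have := nlsEnergy_smul (d := d) p 0 0
    rw [zero_smul] at this
    rw [this]
    simp [energyOf_zero hp]
  refine le_antisymm ?_ (le_iInf₂ fun u hu => ?_)
  · refine (iInf₂_le (0 : L2 d) ⟨?_, by simp⟩).trans h0.le
    rw [memH1_iff]
    have := dirichlet_smul (d := d) 0 0
    rw [zero_smul] at this
    rw [this]
    simp
  · have : u = 0 := by simpa using hu.2
    rw [this, h0]

theorem lintegral_comp_smul {a : ℝ} (ha : 0 < a) (f : EuclideanSpace ℝ (Fin d) → ENNReal) :
    ∫⁻ x, f (a • x) = ENNReal.ofReal ((a ^ d)⁻¹) * ∫⁻ x, f x := by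
  have h := lintegral_map_equiv (μ := volume) f (Homeomorph.smulOfNeZero a ha.ne'
    (α := EuclideanSpace ℝ (Fin d))).toMeasurableEquiv
  have h2 := Measure.map_addHaar_smul (volume : Measure (EuclideanSpace ℝ (Fin d))) ha.ne'
  change ∫⁻ x, f x ∂(Measure.map (a • ·) volume) = ∫⁻ x, f (a • x) at h
  rw [← h, h2, lintegral_smul_measure, abs_of_pos (by positivity), finrank_euclideanSpace_fin,
    smul_eq_mul]

theorem quasiMeasurePreserving_smul {a : ℝ} (ha : 0 < a) :
    Measure.QuasiMeasurePreserving (fun x : EuclideanSpace ℝ (Fin d) => a • x) volume volume := by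
  refine ⟨measurable_const_smul a, ?_⟩
  rw [Measure.map_addHaar_smul _ ha.ne']
  exact Measure.smul_absolutelyContinuous

theorem memLp_comp_smul {a : ℝ} (ha : 0 < a) (u : L2 d) :
    MemLp (fun x => u (a • x)) 2 volume := by
  refine ⟨(Lp.aestronglyMeasurable u).comp_quasiMeasurePreserving
    (quasiMeasurePreserving_smul ha), ?_⟩
  rw [eLpNorm_lt_top_iff_lintegral_rpow_enorm_lt_top (by norm_num) (by norm_num)]
  rw [lintegral_comp_smul ha fun x => ‖u x‖ₑ ^ (2 : ENNReal).toReal]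
  refine ENNReal.mul_lt_top ENNReal.ofReal_lt_top ?_
  rw [← eLpNorm_lt_top_iff_lintegral_rpow_enorm_lt_top (by norm_num) (by norm_num)]
  exact (Lp.memLp u).2

/-- The dilation `x ↦ u (a x)` of an element of `L²`, for `a > 0`. -/
def dilate (a : ℝ) (ha : 0 < a) (u : L2 d) : L2 d := (memLp_comp_smul ha u).toLp

theorem coeFn_dilate {a : ℝ} (ha : 0 < a) (u : L2 d) :
    dilate a ha u =ᵐ[volume] fun x => u (a • x) := MemLp.coeFn_toLp _

theorem enorm_dilate_sq {a : ℝ} (ha : 0 < a) (u : L2 d) :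
    ‖dilate a ha u‖ₑ ^ 2 = ENNReal.ofReal ((a ^ d)⁻¹) * ‖u‖ₑ ^ 2 := by
  rw [enorm_sq_eq_lintegral, enorm_sq_eq_lintegral, ← lintegral_comp_smul ha fun x => ‖u x‖ₑ ^ 2]
  refine lintegral_congr_ae ?_
  filter_upwards [coeFn_dilate ha u] with x hx
  rw [hx]

/-- Change of variables: `ψ` is the dilation of `φ` by `a⁻¹`. -/
theorem toTemperedDistribution_dilate {a : ℝ} (ha : 0 < a) (u : L2 d)
    (φ ψ : SchwartzMap (EuclideanSpace ℝ (Fin d)) ℂ) (h : ∀ x, ψ (a • x) = φ x) :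
    Lp.toTemperedDistribution (dilate a ha u) φ =
      ((a ^ d)⁻¹ : ℝ) • Lp.toTemperedDistribution u ψ := by
  rw [Lp.toTemperedDistribution_apply, Lp.toTemperedDistribution_apply]
  have h1 := Measure.integral_comp_smul (volume : Measure (EuclideanSpace ℝ (Fin d)))
    (fun x => ψ x • u x) a
  rw [finrank_euclideanSpace_fin, abs_of_pos (by positivity)] at h1
  rw [← h1]
  refine integral_congr_ae ?_
  filter_upwards [coeFn_dilate ha u] with x hx
  rw [hx, h]

theorem IsWeakGradient.dilate {a : ℝ} (ha : 0 < a) {u : L2 d} {g : Fin d → L2 d}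
    (h : IsWeakGradient u g) :
    IsWeakGradient (dilate a ha u) (fun j => (a : ℂ) • NLSRelaxation.dilate a ha (g j)) := by
  intro j
  ext φ
  set e : EuclideanSpace ℝ (Fin d) ≃L[ℝ] EuclideanSpace ℝ (Fin d) :=
    ContinuousLinearEquiv.smulLeft (Units.mk0 a⁻¹ (inv_ne_zero ha.ne')) with he
  have hex : ∀ x, e x = a⁻¹ • x := fun x => rfl
  set ψ := SchwartzMap.compCLMOfContinuousLinearEquiv ℂ e φ with hψ
  have hψx : ∀ x, ψ (a • x) = φ x := by
    intro x
    change φ (e (a • x)) = φ x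
    rw [hex, inv_smul_smul₀ ha.ne']
  set m : EuclideanSpace ℝ (Fin d) := EuclideanSpace.single j (1 : ℝ) with hm
  have hd1 : ∀ x, (-((a : ℂ) • LineDeriv.lineDerivOp m ψ)) (a • x) =
      (-(LineDeriv.lineDerivOp m φ)) x := by
    intro x
    rw [hψ, SchwartzMap.lineDerivOp_compCLMOfContinuousLinearEquiv, hex,
      LineDeriv.lineDerivOp_left_smul]
    change -((a : ℂ) * ((a⁻¹ • LineDeriv.lineDerivOp m φ) (e (a • x)))) = _
    rw [hex, inv_smul_smul₀ ha.ne']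
    simp only [smul_apply, neg_apply, Complex.real_smul]
    push_cast
    rw [mul_inv_cancel_left₀ (by exact_mod_cast ha.ne')]
  rw [TemperedDistribution.lineDerivOp_apply_apply, toTemperedDistribution_dilate ha u _ _ hd1]
  have h1 := DFunLike.congr_fun (h j) ((a : ℂ) • ψ)
  rw [TemperedDistribution.lineDerivOp_apply_apply, LineDeriv.lineDerivOp_smul] at h1
  rw [h1, map_smul]
  have h2 : Lp.toTemperedDistribution ((a : ℂ) • NLSRelaxation.dilate a ha (g j)) φ =
      (a : ℂ) • Lp.toTemperedDistribution (NLSRelaxation.dilate a ha (g j)) φ := by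
    rw [← Lp.toTemperedDistributionCLM_apply, map_smul]
    rfl
  rw [h2, toTemperedDistribution_dilate ha (g j) φ ψ hψx, smul_comm]

theorem dirichlet_dilate {a : ℝ} (ha : 0 < a) {u : L2 d} (hu : MemH1 u) :
    dirichlet (dilate a ha u) = ENNReal.ofReal (a ^ 2 * (a ^ d)⁻¹) * dirichlet u := by
  obtain ⟨g, hg⟩ := hu
  rw [(hg.dilate ha).dirichlet_eq, hg.dirichlet_eq, Finset.mul_sum]
  refine Finset.sum_congr rfl fun j _ => ?_
  rw [enorm_smul, mul_pow, enorm_dilate_sq, ENNReal.ofReal_mul (by positivity), ← ofReal_norm,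
    Complex.norm_real, Real.norm_of_nonneg ha.le, ENNReal.ofReal_pow ha.le, mul_assoc]

theorem coe_ennreal_sub_mul {K P : ENNReal} (hK : K ≠ ⊤) {θ : ℝ} (hθ : 0 < θ) :
    ((ENNReal.ofReal θ * K : ENNReal) : EReal) - ((ENNReal.ofReal θ * P : ENNReal) : EReal) =
      ((K : EReal) - (P : EReal)) * (θ : EReal) := by
  rcases eq_or_ne P ⊤ with rfl | hP
  · rw [ENNReal.mul_top (ENNReal.ofReal_pos.2 hθ).ne']
    simp [EReal.bot_mul_coe_of_pos hθ]
  · lift K to NNReal using hK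
    lift P to NNReal using hP
    rw [EReal.coe_ennreal_mul, EReal.coe_ennreal_mul, EReal.coe_ennreal_ofReal, max_eq_left hθ.le]
    simp only [EReal.coe_nnreal_eq_coe_real]
    norm_cast
    ring

/-- If both terms of the energy are multiplied by `θ` under `u ↦ c u(a ·)`, then so is the energy. -/
theorem nlsEnergy_smul_dilate {p : ℝ} (hp : 0 ≤ p) {a : ℝ} (ha : 0 < a) {c θ : ℝ} (hc : 0 ≤ c)
    (hθ : 0 < θ) (h1 : c ^ 2 * (a ^ 2 * (a ^ d)⁻¹) = θ) (h2 : (c ^ 2) ^ p * (a ^ d)⁻¹ = θ)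
    {u : L2 d} (hu : MemH1 u) :
    nlsEnergy p ((c : ℂ) • dilate a ha u) = nlsEnergy p u * (θ : EReal) := by
  have hs : ‖(c : ℂ)‖ₑ ^ 2 = ENNReal.ofReal (c ^ 2) := by
    rw [← ofReal_norm, ← ENNReal.ofReal_pow (norm_nonneg _), Complex.norm_real,
      Real.norm_of_nonneg hc]
  rw [nlsEnergy_smul, hs, dirichlet_dilate ha hu, ← mul_assoc, ← ENNReal.ofReal_mul (by positivity),
    h1, nlsEnergy, energyOf, energyOf, ← coe_ennreal_sub_mul ((memH1_iff u).1 hu).ne hθ]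
  congr 2
  have h3 : ∫⁻ x, (ENNReal.ofReal (c ^ 2) * ‖dilate a ha u x‖ₑ ^ 2) ^ p =
      ENNReal.ofReal θ * ∫⁻ x, (‖u x‖ₑ ^ 2) ^ p := by
    rw [← h2, ENNReal.ofReal_mul (by positivity), mul_assoc,
      ← lintegral_comp_smul ha fun x => (‖u x‖ₑ ^ 2) ^ p,
      ← ENNReal.ofReal_rpow_of_nonneg (by positivity) hp,
      ← lintegral_const_mul' _ _ (by finiteness)]
    refine lintegral_congr_ae ?_
    filter_upwards [coeFn_dilate ha u] with x hx
    rw [hx, ENNReal.mul_rpow_of_nonneg _ _ hp]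
  rw [h3]
  ring_nf

/-- The scaling `u ↦ c u(a ·)` with `c` and `a` chosen such that the two terms of the energy scale
in the same way. The reverse inequality follows by inverting the scaling. -/
theorem I_le_I_mul (hd : 1 ≤ d) {p : ℝ} (hp : 1 < p) (hp' : p < 1 + 2 / (d : ℝ)) {l r : ℝ}
    (hr : 0 < r) : I d p (r * l) ≤
      I d p l * ((r ^ (1 + 2 / (d : ℝ) * ((p - 1) / (1 + 2 / (d : ℝ) - p))) : ℝ) : EReal) := by
  have hd0 : (0 : ℝ) < d := by exact_mod_cast hd
  set α := 1 + 2 / (d : ℝ) * ((p - 1) / (1 + 2 / (d : ℝ) - p)) with hα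
  have hθ : 0 < r ^ α := Real.rpow_pos_of_pos hr _
  have hden : 0 < 1 + 2 / (d : ℝ) - p := by linarith
  set a := r ^ ((α - 1) / 2) with ha
  have ha0 : 0 < a := Real.rpow_pos_of_pos hr _
  -- `c² = r aᵈ` gives the norm, and `a² = r ^ (α - 1)` makes the two terms scale by `r ^ α`
  set c := √(r * a ^ d) with hc
  have hc2 : c ^ 2 = r * a ^ d := Real.sq_sqrt (by positivity)
  have ha2 : a ^ 2 = r ^ (α - 1) := by
    rw [ha, ← Real.rpow_natCast, ← Real.rpow_mul hr.le]
    congr 1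
    push_cast
    ring
  have h1 : c ^ 2 * (a ^ 2 * (a ^ d)⁻¹) = r ^ α := by
    rw [hc2, ha2]
    have : r ^ α = r * r ^ (α - 1) := by
      rw [Real.rpow_sub_one hr.ne']
      field_simp
    rw [this]
    field_simp
  have h2 : (c ^ 2) ^ p * (a ^ d)⁻¹ = r ^ α := by
    rw [hc2, ha, ← Real.rpow_natCast, ← Real.rpow_mul hr.le, ← Real.rpow_one_add' hr.le,
      ← Real.rpow_mul hr.le, ← Real.rpow_neg hr.le, ← Real.rpow_add hr]
    · congr 1
      have h3 : (α - 1) * (1 + 2 / (d : ℝ) - p) = 2 / (d : ℝ) * (p - 1) := by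
        rw [hα, add_sub_cancel_left, mul_assoc, div_mul_cancel₀ _ hden.ne']
      have h4 : (d : ℝ) * (2 / (d : ℝ)) = 2 := by field_simp
      have h5 : (α - 1) * (d + 2 - d * p) = 2 * (p - 1) := by
        linear_combination (d : ℝ) * h3 - (α - 1 - (p - 1)) * h4
      linarith
    · have : 0 ≤ (α - 1) / 2 * d := by
        rw [hα]
        have : 0 ≤ 2 / (d : ℝ) * ((p - 1) / (1 + 2 / (d : ℝ) - p)) := by
          have := sub_pos.2 hp
          positivity
        nlinarith
      linarith
  have key : I d p (r * l) / ((r ^ α : ℝ) : EReal) ≤ I d p l := by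
    refine le_iInf₂ fun u hu => ?_
    rw [EReal.div_le_iff_le_mul (by exact_mod_cast hθ) (EReal.coe_ne_top _),
      mul_comm ((r ^ α : ℝ) : EReal),
      ← nlsEnergy_smul_dilate (by linarith) ha0 (Real.sqrt_nonneg _) hθ h1 h2 hu.1]
    refine iInf₂_le _ ⟨?_, ?_⟩
    · refine MemH1.smul ?_ _
      obtain ⟨g, hg⟩ := hu.1
      exact ⟨_, hg.dilate ha0⟩
    · have h6 : ‖dilate a ha0 u‖ ^ 2 = (a ^ d)⁻¹ * ‖u‖ ^ 2 := by
        have := congrArg ENNReal.toReal (enorm_dilate_sq ha0 u)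
        simpa [ENNReal.toReal_mul, ENNReal.toReal_pow, ENNReal.toReal_ofReal, ha0.le] using this
      rw [norm_smul, mul_pow, h6, hu.2, Complex.norm_real, Real.norm_of_nonneg (Real.sqrt_nonneg _),
        ← hc, hc2]
      field_simp
  rwa [EReal.div_le_iff_le_mul (by exact_mod_cast hθ) (EReal.coe_ne_top _),
    mul_comm ((r ^ α : ℝ) : EReal)] at key

theorem I_eq_I_one_mul (hd : 1 ≤ d) {p : ℝ} (hp : 1 < p) (hp' : p < 1 + 2 / (d : ℝ)) {lam : ℝ}
    (hlam : 0 ≤ lam) : I d p lam =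
      I d p 1 * ((lam ^ (1 + 2 / (d : ℝ) * ((p - 1) / (1 + 2 / (d : ℝ) - p))) : ℝ) : EReal) := by
  have hexp : 0 < 1 + 2 / (d : ℝ) * ((p - 1) / (1 + 2 / (d : ℝ) - p)) := by
    have h1 := sub_pos.2 hp
    have h2 : 0 < 1 + 2 / (d : ℝ) - p := by linarith
    positivity
  set α := 1 + 2 / (d : ℝ) * ((p - 1) / (1 + 2 / (d : ℝ) - p)) with hα
  rcases hlam.eq_or_lt with rfl | hpos
  · rw [I_zero (by linarith), Real.zero_rpow hexp.ne']
    simp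
  · have h1 := I_le_I_mul hd hp hp' (l := 1) hpos
    have h2 := I_le_I_mul hd hp hp' (l := lam) (inv_pos.2 hpos)
    rw [mul_one] at h1
    rw [inv_mul_cancel₀ hpos.ne'] at h2
    refine le_antisymm h1 ?_
    have hθ : 0 < lam ^ α := Real.rpow_pos_of_pos hpos _
    calc I d p 1 * ((lam ^ α : ℝ) : EReal)
        ≤ I d p lam * ((lam⁻¹ ^ α : ℝ) : EReal) * ((lam ^ α : ℝ) : EReal) :=
          mul_le_mul_of_nonneg_right h2 (by exact_mod_cast hθ.le)
      _ = I d p lam := by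
          rw [mul_assoc, ← EReal.coe_mul, Real.inv_rpow hlam, inv_mul_cancel₀ hθ.ne',
            EReal.coe_one, mul_one]

theorem J_eq_I (hd : 1 ≤ d) {p : ℝ} (hp : 1 ≤ p) {lam : ℝ} (h0 : 0 ≤ lam) (h1 : lam ≤ 1) :
    J d p lam = I d p lam := by
  rcases h0.eq_or_lt with rfl | hpos
  · rw [J_zero hd (by linarith), I_zero (by linarith)]
  · rw [J_eq_finiteRankInf hd hp hpos (N := 1) ⟨by simpa using h1, fun n hn => ?_⟩,
      finiteRankInf_one_eq_I hd p hpos]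
    have : (0 : ℝ) < n := hpos.trans_le hn
    exact_mod_cast this

end NLSRelaxation

end

/-! ### Low and high frequencies -/

section

open MeasureTheory ENNReal Filter Topology FourierTransform

namespace NLSRelaxation

variable {d : ℕ}

/-- An `L²` function with integrable Fourier transform is bounded by the `L¹` norm of the latter. -/
theorem ae_enorm_le_lintegral_fourier {v : L2 d} (hv : Integrable (𝓕 v : L2 d) volume) :
    ∀ᵐ x, ‖v x‖ₑ ≤ ∫⁻ ξ, ‖(𝓕 v : L2 d) ξ‖ₑ := by
  set L := -innerₗ (EuclideanSpace ℝ (Fin d)) with hL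
  have hLc : Continuous fun q : EuclideanSpace ℝ (Fin d) × EuclideanSpace ℝ (Fin d) =>
      L q.1 q.2 := by
    change Continuous fun q : EuclideanSpace ℝ (Fin d) × EuclideanSpace ℝ (Fin d) =>
      -(inner ℝ q.1 q.2)
    fun_prop
  have hLc' : Continuous fun q : EuclideanSpace ℝ (Fin d) × EuclideanSpace ℝ (Fin d) =>
      L.flip q.1 q.2 := hLc.comp continuous_swap
  set w := VectorFourier.fourierIntegral Real.fourierChar volume L.flip (𝓕 v : L2 d) with hw
  have hwc : Continuous w :=
    VectorFourier.fourierIntegral_continuous Real.continuous_fourierChar hLc' hv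
  -- `v` is the inverse Fourier integral of `𝓕 v`, as seen by testing against Schwartz functions
  have hvw : ∀ᵐ x, v x = w x := by
    refine ae_eq_of_integral_contDiff_smul_eq ((Lp.memLp v).locallyIntegrable (by norm_num))
      hwc.locallyIntegrable fun φ hφ hφc => ?_
    have hg₁ : HasCompactSupport (Complex.ofRealCLM ∘ φ) := hφc.comp_left rfl
    have hg₂ : ContDiff ℝ ((⊤ : ℕ∞) : WithTop ℕ∞) (Complex.ofRealCLM ∘ φ) := by fun_prop
    set ψ := hg₁.toSchwartzMap hg₂ with hψ
    have h1 : Lp.toTemperedDistribution v ψ =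
        Lp.toTemperedDistribution (𝓕 v : L2 d) (𝓕⁻ ψ) := by
      rw [← TemperedDistribution.fourierInv_apply, Lp.fourierInv_toTemperedDistribution_eq,
        FourierTransform.fourierInv_fourier_eq]
    rw [Lp.toTemperedDistribution_apply, Lp.toTemperedDistribution_apply] at h1
    have h2 := VectorFourier.integral_fourierIntegral_smul_eq_flip (L := L) (μ := volume)
      (ν := volume) Real.continuous_fourierChar hLc ψ.integrable hv
    have h3 : ∀ ξ, (𝓕⁻ ψ) ξ = VectorFourier.fourierIntegral Real.fourierChar volume L ψ ξ := by
      intro ξ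
      rw [SchwartzMap.fourierInv_coe]
      rfl
    simp_rw [h3] at h1
    rw [h2] at h1
    simpa [hψ] using h1
  filter_upwards [hvw] with x hx
  rw [hx, ← ofReal_norm, ← ofReal_integral_norm_eq_lintegral_enorm hv]
  exact ENNReal.ofReal_le_ofReal (VectorFourier.norm_fourierIntegral_le_integral_norm _ _ _ _ _)

/-- Functions with Fourier transform supported in a set of finite volume are bounded. -/
theorem ae_enorm_fourierInv_restrictTo_sq_le {S : Set (EuclideanSpace ℝ (Fin d))}
    (hS : MeasurableSet S) (hSt : volume S ≠ ⊤) (w : L2 d) :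
    ∀ᵐ x, ‖(𝓕⁻ (restrictTo S hS w) : L2 d) x‖ₑ ^ 2 ≤ volume S * ‖w‖ₑ ^ 2 := by
  have h1 : eLpNorm w 1 (volume.restrict S) ≤ volume S ^ (1 / 2 : ℝ) * ‖w‖ₑ := by
    have h := eLpNorm_le_eLpNorm_mul_rpow_measure_univ (μ := volume.restrict S) (f := w)
      (p := 1) (q := 2) (by norm_num) (Lp.aestronglyMeasurable w).restrict
    rw [Measure.restrict_apply_univ] at h
    refine h.trans ?_
    rw [mul_comm, Lp.enorm_def]
    norm_num
    gcongr
    exact Measure.restrict_le_self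
  have hint : ∫⁻ ξ, ‖restrictTo S hS w ξ‖ₑ = eLpNorm w 1 (volume.restrict S) := by
    rw [eLpNorm_one_eq_lintegral_enorm, ← lintegral_indicator hS]
    refine lintegral_congr_ae ?_
    filter_upwards [coeFn_restrictTo hS w] with x hx
    rw [hx]
    by_cases h : x ∈ S <;> simp [h]
  have hI : Integrable (𝓕 (𝓕⁻ (restrictTo S hS w) : L2 d) : L2 d) volume := by
    rw [FourierTransform.fourier_fourierInv_eq]
    refine ⟨Lp.aestronglyMeasurable _, ?_⟩
    rw [HasFiniteIntegral, hint]
    exact h1.trans_lt (ENNReal.mul_lt_top (ENNReal.rpow_lt_top_of_nonneg (by norm_num) hSt)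
      enorm_lt_top)
  filter_upwards [ae_enorm_le_lintegral_fourier hI] with x hx
  rw [FourierTransform.fourier_fourierInv_eq, hint] at hx
  calc _ ≤ (volume S ^ (1 / 2 : ℝ) * ‖w‖ₑ) ^ 2 := by gcongr; exact hx.trans h1
    _ = _ := by
      rw [mul_pow, ← ENNReal.rpow_natCast (volume S ^ (1 / 2 : ℝ)), ← ENNReal.rpow_mul]
      norm_num

/-- If the distribution function of `f` is controlled by `4/τ` times that of `g`, then the `p`-th
moment of `f` is controlled by the `(p - 1)`-th moment of `g`. -/
theorem lintegral_rpow_le_of_measure_lt_le {α β : Type*} [MeasurableSpace α] [MeasurableSpace β]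
    {μ : Measure α} {ν : Measure β} {f : α → ℝ} {g : β → ℝ} (hf : ∀ a, 0 ≤ f a)
    (hfm : AEMeasurable f μ) (hg : ∀ b, 0 ≤ g b) (hgm : AEMeasurable g ν) {p : ℝ} (hp : 1 < p)
    (h : ∀ τ : ℝ, 0 < τ → μ {a | τ < f a} ≤ ENNReal.ofReal (4 / τ) * ν {b | τ < g b}) :
    ENNReal.ofReal (p - 1) * ∫⁻ a, ENNReal.ofReal (f a ^ p) ∂μ ≤
      ENNReal.ofReal (4 * p) * ∫⁻ b, ENNReal.ofReal (g b ^ (p - 1)) ∂ν := by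
  rw [lintegral_rpow_eq_lintegral_meas_lt_mul μ (ae_of_all _ hf) hfm (by linarith),
    lintegral_rpow_eq_lintegral_meas_lt_mul ν (ae_of_all _ hg) hgm (by linarith : 0 < p - 1)]
  have h1 : ∫⁻ t in Set.Ioi (0 : ℝ), μ {a | t < f a} * ENNReal.ofReal (t ^ (p - 1)) ≤
      4 * ∫⁻ t in Set.Ioi (0 : ℝ), ν {b | t < g b} * ENNReal.ofReal (t ^ (p - 1 - 1)) := by
    rw [← lintegral_const_mul' _ _ (by norm_num)]
    refine setLIntegral_mono' measurableSet_Ioi fun t ht => ?_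
    rw [Set.mem_Ioi] at ht
    calc μ {a | t < f a} * ENNReal.ofReal (t ^ (p - 1))
        ≤ ENNReal.ofReal (4 / t) * ν {b | t < g b} * ENNReal.ofReal (t ^ (p - 1)) := by
          gcongr; exact h t ht
      _ = ENNReal.ofReal (4 / t * t ^ (p - 1)) * ν {b | t < g b} := by
          rw [ENNReal.ofReal_mul (by positivity)]; ring
      _ = 4 * (ν {b | t < g b} * ENNReal.ofReal (t ^ (p - 1 - 1))) := by
          have : 4 / t * t ^ (p - 1) = 4 * t ^ (p - 1 - 1) := by
            rw [Real.rpow_sub_one ht.ne' (p - 1)]; field_simp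
          rw [this, ENNReal.ofReal_mul (by norm_num)]
          norm_num
          ring
  calc _ ≤ ENNReal.ofReal (p - 1) * (ENNReal.ofReal p * (4 * ∫⁻ t in Set.Ioi (0 : ℝ),
        ν {b | t < g b} * ENNReal.ofReal (t ^ (p - 1 - 1)))) := by gcongr
    _ = _ := by
      rw [ENNReal.ofReal_mul (by norm_num)]
      norm_num
      ring

theorem exists_mul_rpow_le {A b s : ℝ} (hA : 0 ≤ A) (hb : 0 < b) (hs : 0 ≤ s) (hs2 : s < 2) :
    ∃ C, 0 ≤ C ∧ ∀ x : ℝ, 0 ≤ x → A * x ^ s ≤ C + b * x ^ 2 := by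
  -- for `x ≥ X` the quadratic term alone dominates
  set X := (A / b) ^ (1 / (2 - s)) with hX
  have hX0 : 0 ≤ X := by positivity
  refine ⟨A * X ^ s, by positivity, fun x hx => ?_⟩
  rcases le_or_gt x X with h | h
  · have : A * x ^ s ≤ A * X ^ s := by gcongr
    nlinarith [mul_nonneg hb.le (sq_nonneg x)]
  · have hx0 : 0 < x := hX0.trans_lt h
    have h1 : A / b ≤ x ^ (2 - s) := by
      calc A / b = X ^ (2 - s) := by
            rw [hX, ← Real.rpow_mul (by positivity), one_div_mul_cancel (by linarith),
              Real.rpow_one]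
        _ ≤ _ := Real.rpow_le_rpow hX0 h.le (by linarith)
    have h2 : x ^ (2 - s) * x ^ s = x ^ 2 := by
      rw [← Real.rpow_add hx0, ← Real.rpow_natCast]
      congr 1
      push_cast
      ring
    have h3 : A ≤ b * x ^ (2 - s) := by rwa [div_le_iff₀' hb] at h1
    have h4 : 0 ≤ x ^ s := by positivity
    have h5 : 0 ≤ A * X ^ s := by positivity
    calc A * x ^ s ≤ b * x ^ (2 - s) * x ^ s := by gcongr
      _ = b * x ^ 2 := by rw [mul_assoc, h2]
      _ ≤ _ := by linarith

theorem enorm_add_sq_le (z w : ℂ) : ‖z + w‖ₑ ^ 2 ≤ 2 * ‖z‖ₑ ^ 2 + 2 * ‖w‖ₑ ^ 2 := by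
  have h : ‖z + w‖ ^ 2 ≤ 2 * ‖z‖ ^ 2 + 2 * ‖w‖ ^ 2 := by
    have h1 := norm_add_le z w
    nlinarith [sq_nonneg (‖z‖ - ‖w‖), norm_nonneg (z + w)]
  have h2 := ENNReal.ofReal_le_ofReal h
  rw [ENNReal.ofReal_add (by positivity) (by positivity), ENNReal.ofReal_mul (by norm_num),
    ENNReal.ofReal_mul (by norm_num)] at h2
  simpa [ENNReal.ofReal_pow, ofReal_norm] using h2

theorem restrictTo_add_restrictTo_compl {S : Set (EuclideanSpace ℝ (Fin d))}
    (hS : MeasurableSet S) (w : L2 d) : restrictTo S hS w + restrictTo Sᶜ hS.compl w = w := by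
  ext1
  filter_upwards [Lp.coeFn_add (restrictTo S hS w) (restrictTo Sᶜ hS.compl w),
    coeFn_restrictTo hS w, coeFn_restrictTo hS.compl w] with x h1 h2 h3
  rw [h1, Pi.add_apply, h2, h3, ← Pi.add_apply, Set.indicator_self_add_compl]

/-- Splitting the orbitals into low and high frequencies: the low frequencies contribute a bounded
density, so that the level sets of the density are controlled by the high frequencies. The factor `4`
comes from `|z + w|² ≤ 2|z|² + 2|w|²` and from giving half of `τ` to each part. -/
theorem measure_density_gt_le {n : ℕ → ENNReal} {u : ℕ → L2 d} (hu : ∀ i, ‖u i‖ₑ = 1) {τ : ℝ}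
    (hτ : 0 < τ) {S : Set (EuclideanSpace ℝ (Fin d))} (hS : MeasurableSet S)
    (hSt : volume Sᶜ ≠ ⊤) (hvol : volume Sᶜ * ∑' i, n i ≤ ENNReal.ofReal (τ / 4)) :
    volume {x | ENNReal.ofReal τ < ∑' i, n i * ‖u i x‖ₑ ^ 2} ≤
      ENNReal.ofReal (4 / τ) * ∫⁻ ξ in S, ∑' i, n i * ‖(𝓕 (u i) : L2 d) ξ‖ₑ ^ 2 := by
  set lo : ℕ → L2 d := fun i => 𝓕⁻ (restrictTo Sᶜ hS.compl (𝓕 (u i))) with hlo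
  set hi : ℕ → L2 d := fun i => 𝓕⁻ (restrictTo S hS (𝓕 (u i))) with hhi
  have hsum : ∀ i, hi i + lo i = u i := by
    intro i
    rw [hhi, hlo, ← FourierTransform.fourierInv_add, restrictTo_add_restrictTo_compl,
      FourierTransform.fourierInv_fourier_eq]
  have hlow : ∀ᵐ x, ∀ i, ‖lo i x‖ₑ ^ 2 ≤ volume Sᶜ := by
    rw [ae_all_iff]
    intro i
    filter_upwards [ae_enorm_fourierInv_restrictTo_sq_le hS.compl hSt (𝓕 (u i) : L2 d)] with x hx
    rwa [enorm_fourier, hu, one_pow, mul_one] at hx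
  have hsum' : ∀ᵐ x, ∀ i, u i x = hi i x + lo i x := by
    rw [ae_all_iff]
    intro i
    filter_upwards [Lp.coeFn_add (hi i) (lo i)] with x hx
    rw [← Pi.add_apply, ← hx, hsum]
  set ρ : EuclideanSpace ℝ (Fin d) → ENNReal := fun x => ∑' i, n i * ‖hi i x‖ₑ ^ 2 with hρ
  -- where the density exceeds `τ`, the high frequencies contribute at least `τ / 4`
  have hsub : ∀ᵐ x, ENNReal.ofReal τ < ∑' i, n i * ‖u i x‖ₑ ^ 2 →
      ENNReal.ofReal (τ / 4) ≤ ρ x := by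
    filter_upwards [hlow, hsum'] with x hx1 hx2 hx3
    by_contra hcon
    rw [not_le] at hcon
    refine absurd hx3 (not_lt.2 ?_)
    calc ∑' i, n i * ‖u i x‖ₑ ^ 2
        ≤ ∑' i, (2 * (n i * ‖hi i x‖ₑ ^ 2) + 2 * (volume Sᶜ * n i)) := by
          refine ENNReal.tsum_le_tsum fun i => ?_
          rw [hx2 i]
          calc n i * ‖hi i x + lo i x‖ₑ ^ 2
              ≤ n i * (2 * ‖hi i x‖ₑ ^ 2 + 2 * volume Sᶜ) := by
                gcongr
                refine (enorm_add_sq_le _ _).trans ?_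
                gcongr
                exact hx1 i
            _ = _ := by ring
      _ = 2 * ρ x + 2 * (volume Sᶜ * ∑' i, n i) := by
          rw [ENNReal.tsum_add, ENNReal.tsum_mul_left, ENNReal.tsum_mul_left,
            ENNReal.tsum_mul_left]
      _ ≤ 2 * ENNReal.ofReal (τ / 4) + 2 * ENNReal.ofReal (τ / 4) := by gcongr
      _ = ENNReal.ofReal τ := by
          have h2 : (2 : ENNReal) = ENNReal.ofReal 2 := by norm_num
          rw [h2, ← ENNReal.ofReal_mul (by norm_num), ← ENNReal.ofReal_add (by positivity)
            (by positivity)]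
          congr 1
          ring
  have hτ4 : ENNReal.ofReal (τ / 4) ≠ 0 := (ENNReal.ofReal_pos.2 (by positivity)).ne'
  have hint : ∫⁻ x, ρ x = ∫⁻ ξ in S, ∑' i, n i * ‖(𝓕 (u i) : L2 d) ξ‖ₑ ^ 2 := by
    have hm (w : L2 d) : Measurable fun x => ‖w x‖ₑ ^ 2 :=
      (Lp.stronglyMeasurable w).enorm.pow_const 2
    rw [hρ, lintegral_tsum fun i => ((hm _).const_mul _).aemeasurable,
      lintegral_tsum fun i => ((hm _).const_mul _).aemeasurable]
    congr 1
    ext i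
    rw [lintegral_const_mul _ (hm _), lintegral_const_mul _ (hm _), ← enorm_restrictTo_sq hS,
      ← enorm_sq_eq_lintegral, ← enorm_fourier (hi i), hhi,
      FourierTransform.fourier_fourierInv_eq]
  calc volume {x | ENNReal.ofReal τ < ∑' i, n i * ‖u i x‖ₑ ^ 2}
      ≤ volume {x | ENNReal.ofReal (τ / 4) ≤ ρ x} := measure_mono_ae hsub
    _ ≤ (∫⁻ x, ρ x) / ENNReal.ofReal (τ / 4) :=
        meas_ge_le_lintegral_div (measurable_tsum_enorm_sq _ _).aemeasurable hτ4
          ENNReal.ofReal_ne_top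
    _ = _ := by
        rw [hint, div_eq_mul_inv, mul_comm, ← ENNReal.ofReal_inv_of_pos (by positivity), inv_div]

end NLSRelaxation

end

/-! ### The lower bound -/

section

open MeasureTheory ENNReal Filter Topology FourierTransform

namespace NLSRelaxation

variable {d : ℕ}

theorem lintegral_tsum_mul_enorm_sq {n : ℕ → ENNReal} {u : ℕ → L2 d} (hu : ∀ i, ‖u i‖ₑ = 1) :
    ∫⁻ x, ∑' i, n i * ‖u i x‖ₑ ^ 2 = ∑' i, n i := by
  have hm (w : L2 d) : Measurable fun x => ‖w x‖ₑ ^ 2 :=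
    (Lp.stronglyMeasurable w).enorm.pow_const 2
  rw [lintegral_tsum fun i => ((hm _).const_mul _).aemeasurable]
  congr 1
  ext i
  rw [lintegral_const_mul _ (hm _), ← enorm_sq_eq_lintegral, hu, one_pow, mul_one]

/-- The low frequencies `B |ξ|ᵈ ≤ τ` fill a ball of volume `τ / B` times that of the unit ball. -/
theorem volume_low_frequencies_le (hd : 1 ≤ d) {B τ : ℝ} (hB : 0 < B) (hτ : 0 < τ) :
    volume {ξ : EuclideanSpace ℝ (Fin d) | τ < B * ‖ξ‖ ^ d}ᶜ ≤
      ENNReal.ofReal (τ / B) * volume (Metric.ball (0 : EuclideanSpace ℝ (Fin d)) 1) := by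
  have hd0 : d ≠ 0 := by omega
  set R := (τ / B) ^ ((d : ℝ)⁻¹) with hR
  have hR0 : 0 ≤ R := by positivity
  have hRd : R ^ d = τ / B := Real.rpow_inv_natCast_pow (by positivity) hd0
  calc _ ≤ volume (Metric.closedBall (0 : EuclideanSpace ℝ (Fin d)) R) := by
        refine measure_mono fun ξ hξ => ?_
        simp only [Set.mem_compl_iff, Set.mem_ofPred_eq, not_lt] at hξ
        rw [mem_closedBall_zero_iff]
        refine (pow_le_pow_iff_left₀ (norm_nonneg _) hR0 hd0).1 ?_
        rw [hRd, le_div_iff₀' hB]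
        exact hξ
    _ = _ := by
        rw [Measure.addHaar_closedBall _ _ hR0, finrank_euclideanSpace_fin, hRd]

/-- The Gagliardo–Nirenberg type bound behind the stability of the relaxed problem: for
`p < 1 + 2/d` the `p`-th moment of the density is controlled by a constant and a multiple of the
kinetic energy. -/
theorem exists_lintegral_density_rpow_le (hd : 1 ≤ d) {p : ℝ} (hp : 1 < p)
    (hp' : p < 1 + 2 / (d : ℝ)) {lam : ℝ} (hlam : 0 < lam) :
    ∃ C : ℝ, 0 ≤ C ∧ ∀ (n : ℕ → ENNReal) (u : ℕ → L2 d), (∀ i, ‖u i‖ₑ = 1) →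
      ∑' i, n i = ENNReal.ofReal lam →
      ∫⁻ x, (∑' i, n i * ‖u i x‖ₑ ^ 2) ^ p ≤
        ENNReal.ofReal C + ENNReal.ofReal p * ∑' i, n i * dirichlet (u i) := by
  have hd0 : (0 : ℝ) < d := by exact_mod_cast hd
  have hp1 : 0 < p - 1 := sub_pos.2 hp
  set ω := (volume (Metric.ball (0 : EuclideanSpace ℝ (Fin d)) 1)).toReal with hω
  have hω0 : 0 < ω := ENNReal.toReal_pos (Metric.measure_ball_pos _ _ one_pos).ne'
    measure_ball_lt_top.ne
  have hωe : volume (Metric.ball (0 : EuclideanSpace ℝ (Fin d)) 1) = ENNReal.ofReal ω :=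
    (ENNReal.ofReal_toReal measure_ball_lt_top.ne).symm
  -- with this choice, `λ` times the volume of the low frequencies `B |ξ|ᵈ ≤ τ` is `τ / 4`
  set B := 4 * lam * ω with hB
  have hB0 : 0 < B := by positivity
  have hs2 : d * (p - 1) < 2 := by
    have : p - 1 < 2 / d := by linarith
    rwa [lt_div_iff₀' hd0] at this
  obtain ⟨C, hC0, hC⟩ := exists_mul_rpow_le (A := 4 * p / (p - 1) * B ^ (p - 1))
    (b := p * (4 * Real.pi ^ 2)) (s := d * (p - 1)) (by positivity) (by positivity)
    (by positivity) hs2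
  refine ⟨C * lam, by positivity, fun n u hu hn => ?_⟩
  set ρ : EuclideanSpace ℝ (Fin d) → ENNReal := fun x => ∑' i, n i * ‖u i x‖ₑ ^ 2 with hρ
  set ρh : EuclideanSpace ℝ (Fin d) → ENNReal := fun ξ => ∑' i, n i * ‖(𝓕 (u i) : L2 d) ξ‖ₑ ^ 2
    with hρh
  have hρm : Measurable ρ := measurable_tsum_enorm_sq _ _
  have hρhm : Measurable ρh := measurable_tsum_enorm_sq _ _
  have hρt : ∀ᵐ x, ρ x < ⊤ := by
    refine ae_lt_top hρm ?_
    rw [hρ, lintegral_tsum_mul_enorm_sq hu, hn]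
    exact ENNReal.ofReal_ne_top
  have hρh1 : ∫⁻ ξ, ρh ξ = ENNReal.ofReal lam := by
    rw [hρh, lintegral_tsum_mul_enorm_sq (fun i => by rw [enorm_fourier, hu]), hn]
  have hlevel : ∀ τ : ℝ, 0 < τ → volume {x | τ < (ρ x).toReal} ≤
      ENNReal.ofReal (4 / τ) * (volume.withDensity ρh) {ξ | τ < B * ‖ξ‖ ^ d} := by
    intro τ hτ
    have hS : MeasurableSet {ξ : EuclideanSpace ℝ (Fin d) | τ < B * ‖ξ‖ ^ d} :=
      measurableSet_lt measurable_const (by fun_prop)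
    have hvol := volume_low_frequencies_le hd hB0 hτ
    rw [hωe, ← ENNReal.ofReal_mul (by positivity)] at hvol
    rw [withDensity_apply _ hS]
    refine le_trans (measure_mono fun x hx => ?_) (measure_density_gt_le hu hτ hS
      (ne_top_of_le_ne_top ENNReal.ofReal_ne_top hvol) ?_)
    · have hx' : τ < (ρ x).toReal := hx
      have hxt : ρ x ≠ ⊤ := by
        intro h
        rw [h, ENNReal.toReal_top] at hx'
        exact absurd hx' hτ.not_gt
      exact (ENNReal.ofReal_lt_iff_lt_toReal hτ.le hxt).2 hx'
    · rw [hn]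
      refine (mul_le_mul_left hvol _).trans (le_of_eq ?_)
      rw [← ENNReal.ofReal_mul (by positivity)]
      congr 1
      rw [hB]
      field_simp
  -- integrating over the levels `τ`
  have hlayer := lintegral_rpow_le_of_measure_lt_le (μ := volume) (ν := volume.withDensity ρh)
    (f := fun x => (ρ x).toReal) (g := fun ξ : EuclideanSpace ℝ (Fin d) => B * ‖ξ‖ ^ d)
    (fun x => ENNReal.toReal_nonneg) hρm.ennreal_toReal.aemeasurable (fun ξ => by positivity)
    (Measurable.aemeasurable (by fun_prop)) hp hlevel
  have hleft : ∫⁻ x, ENNReal.ofReal ((ρ x).toReal ^ p) = ∫⁻ x, ρ x ^ p := by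
    refine lintegral_congr_ae ?_
    filter_upwards [hρt] with x hx
    rw [← ENNReal.ofReal_rpow_of_nonneg ENNReal.toReal_nonneg (by linarith),
      ENNReal.ofReal_toReal hx.ne]
  rw [hleft, lintegral_withDensity_eq_lintegral_mul _ hρhm (by fun_prop)] at hlayer
  simp only [Pi.mul_apply] at hlayer
  calc ∫⁻ x, ρ x ^ p
      = ENNReal.ofReal (1 / (p - 1)) * (ENNReal.ofReal (p - 1) * ∫⁻ x, ρ x ^ p) := by
        rw [← mul_assoc, ← ENNReal.ofReal_mul (by positivity), one_div_mul_cancel hp1.ne',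
          ENNReal.ofReal_one, one_mul]
    _ ≤ ENNReal.ofReal (1 / (p - 1)) * (ENNReal.ofReal (4 * p) * ∫⁻ ξ,
          ρh ξ * ENNReal.ofReal ((B * ‖ξ‖ ^ d) ^ (p - 1))) := mul_le_mul' le_rfl hlayer
    _ = ∫⁻ ξ, ρh ξ * ENNReal.ofReal (4 * p / (p - 1) * B ^ (p - 1) * ‖ξ‖ ^ (d * (p - 1))) := by
        rw [← mul_assoc, ← ENNReal.ofReal_mul (by positivity),
          ← lintegral_const_mul' _ _ ENNReal.ofReal_ne_top]
        congr 1
        ext ξ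
        rw [mul_left_comm, ← ENNReal.ofReal_mul (by positivity),
          Real.mul_rpow hB0.le (by positivity), ← Real.rpow_natCast, ← Real.rpow_mul
          (norm_nonneg _)]
        congr 2
        field_simp
    _ ≤ ∫⁻ ξ, (ENNReal.ofReal C * ρh ξ + ENNReal.ofReal p * (symbol ξ * ρh ξ)) := by
        refine lintegral_mono fun ξ => ?_
        calc _ ≤ ρh ξ * ENNReal.ofReal (C + p * (4 * Real.pi ^ 2) * ‖ξ‖ ^ 2) := by
              gcongr
              exact hC ‖ξ‖ (norm_nonneg _)
          _ = _ := by
              rw [ENNReal.ofReal_add hC0 (by positivity), symbol, mul_assoc p,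
                ENNReal.ofReal_mul (by linarith)]
              ring
    _ = _ := by
        have hsm : Measurable fun ξ => symbol ξ * ρh ξ := measurable_symbol.mul hρhm
        rw [lintegral_add_left (hρhm.const_mul _), lintegral_const_mul _ hρhm,
          lintegral_const_mul _ hsm, hρh1, tsum_mul_dirichlet,
          ENNReal.ofReal_mul hC0]

/-- The relaxed energy is bounded from below on the admissible operators. -/
theorem exists_le_energy (hd : 1 ≤ d) {p : ℝ} (hp : 1 < p) (hp' : p < 1 + 2 / (d : ℝ)) {lam : ℝ}
    (hlam : 0 < lam) :
    ∃ C : ℝ, ∀ γ : L2 d →L[ℂ] L2 d, Admissible lam γ → (C : EReal) ≤ energy p γ := by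
  obtain ⟨C, hC0, hC⟩ := exists_lintegral_density_rpow_le hd hp hp' hlam
  refine ⟨-(C / p), fun γ hγ => ?_⟩
  obtain ⟨n, u, hnu, -, hn, hK⟩ := hγ.exists_isDiagonalisation hd
  rw [hnu.energy_eq, energyOf]
  have hbound := hC (fun i => ENNReal.ofReal (n i)) u hnu.enorm_eq_one hn
  set K := ∑' i, ENNReal.ofReal (n i) * dirichlet (u i) with hKdef
  set P := ∫⁻ x, (∑' i, ENNReal.ofReal (n i) * ‖u i x‖ₑ ^ 2) ^ p with hPdef
  have hP : ENNReal.ofReal (1 / p) * P ≤ ENNReal.ofReal (C / p) + K := by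
    calc ENNReal.ofReal (1 / p) * P
        ≤ ENNReal.ofReal (1 / p) * (ENNReal.ofReal C + ENNReal.ofReal p * K) := by gcongr
      _ = _ := by
        rw [mul_add, ← mul_assoc, ← ENNReal.ofReal_mul (by positivity),
          ← ENNReal.ofReal_mul (by positivity), one_div_mul_cancel (by linarith),
          ENNReal.ofReal_one, one_mul, one_div_mul_eq_div]
  -- in particular the subtraction in the energy is one of real numbers
  have hPt : ENNReal.ofReal (1 / p) * P ≠ ⊤ :=
    ne_top_of_le_ne_top (ENNReal.add_ne_top.2 ⟨ENNReal.ofReal_ne_top, hK.ne⟩) hP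
  generalize ENNReal.ofReal (1 / p) * P = Q at hP hPt
  lift Q to NNReal using hPt
  clear_value K
  lift K to NNReal using hK.ne
  rw [EReal.coe_nnreal_eq_coe_real, EReal.coe_nnreal_eq_coe_real, ← EReal.coe_sub,
    EReal.coe_le_coe_iff]
  have h1 := ENNReal.toReal_mono (by finiteness) hP
  rw [ENNReal.toReal_add (by finiteness) (by finiteness), ENNReal.toReal_ofReal
    (by positivity), ENNReal.coe_toReal, ENNReal.coe_toReal] at h1
  linarith

end NLSRelaxation

end

theorem mainTheorem9 (d : ℕ) (hd : 1 ≤ d) (p : ℝ) (hp : 1 < p) (hp' : p < 1 + 2 / (d : ℝ)) :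
    -- the relaxed problem is bounded from below
    (∀ lam : ℝ, 0 < lam →
      ∃ C : ℝ, ∀ γ : NLSRelaxation.L2 d →L[ℂ] NLSRelaxation.L2 d,
        NLSRelaxation.Admissible lam γ → (C : EReal) ≤ NLSRelaxation.energy p γ) ∧
    -- restriction to `N - 1` occupation numbers equal to `1` and one equal to `λ - N + 1`
    (∀ lam : ℝ, 0 < lam → ∀ N : ℕ, IsLeast {n : ℕ | lam ≤ (n : ℝ)} N →
      NLSRelaxation.J d p lam = NLSRelaxation.finiteRankInf d p N lam) ∧
    -- (i) integer case
    (∀ N : ℕ, NLSRelaxation.J d p (N : ℝ) = NLSRelaxation.orthonormalInf d p N) ∧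
    -- (ii) `J(λ) = I(λ) = I(1) λ ^ (1 + (2/d) (p - 1) / (1 + 2/d - p))` for `0 ≤ λ ≤ 1`
    (∀ lam : ℝ, 0 ≤ lam → lam ≤ 1 →
      NLSRelaxation.J d p lam = NLSRelaxation.I d p lam ∧
      NLSRelaxation.I d p lam = NLSRelaxation.I d p 1 *
        ((lam ^ (1 + 2 / (d : ℝ) * ((p - 1) / (1 + 2 / (d : ℝ) - p))) : ℝ) : EReal)) :=
  ⟨fun _ hlam => NLSRelaxation.exists_le_energy hd hp hp' hlam,
    fun _ hlam _ hN => NLSRelaxation.J_eq_finiteRankInf hd hp.le hlam hN,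
    fun N => NLSRelaxation.J_natCast hd hp.le N,
    fun _ h0 h1 => ⟨NLSRelaxation.J_eq_I hd hp.le h0 h1, NLSRelaxation.I_eq_I_one_mul hd hp hp' h0⟩⟩

end
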